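/- Let $(\sigma_t)_{t\in\mathbb Z}$ be a strictly stationary, positive process and let $(Z_t)_{t\in\mathbb Z}$ be an i.i.d. sequence of standard normal random variables on the same probability space, such that the processes $\sigma$ and $Z$ are independent. Put $X_t=\sigma_tZ_t$. Let $p\ge 1$ be fixed. Mixing. Let $\mathcal F_a^b$ be the $\sigma$-algebra generated by $\sigma_j$, $a\le j\le b$, and $\alpha_k=\sup\{|P(A\cap B)-P(A)P(B)| : A\in\mathcal F_{-\infty}^0,\ B\in\mathcal F_k^\infty\}$. Assume that $\sigma$ is strongly mixing, i.e. $\alpha_k\to0$, and that $\sum_{j=1}^\infty\alpha_j^\beta<\infty$ for some $\beta\in(0,1)$. Kernel (Condition W). Let $w:\mathbb R\to\mathbb R$ be symmetric with $\int|w(u)|\,du<\infty$, $\int w(u)\,du=1$, $\int u^2|w(u)|\,du<\infty$ and $\lim_{|u|\to\infty}w(u)=0$; let $\phi_w(t)=\int e^{itu}w(u)\,du$ have (closed) support $[-1,1]$ and satisfy $\phi_w(1-t)=At^\alpha+o(t^\alpha)$ as $t\downarrow0$, for some $A\in\mathbb R$ and $\alpha>0$. Density. Assume that the vector $(\log\sigma_p^2,\log\sigma_{p-1}^2,\ldots,\log\sigma_1^2)$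 has a density $f$ on $\mathbb R^p$ that is bounded and twice continuously differentiable with bounded second order partial derivatives. Estimator. Let $k(x)=\frac1{\sqrt{2\pi}}e^{x/2}e^{-e^x/2}$ (the density of $\log Z_t^2$), $\mathbf w(\mathbf x)=\prod_{i=1}^pw(x_i)$, $\mathbf k(\mathbf x)=\prod_{i=1}^pk(x_i)$, let $\phi_{\mathbf w},\phi_{\mathbf k}$ be the Fourier transforms $\phi_{\mathbf g}(\mathbf s)=\int_{\mathbb R^p} e^{i\mathbf s\cdot\mathbf u}\mathbf g(\mathbf u)\,d\mathbf u$, and for $h>0$, $n\ge p$ and $\mathbf x\in\mathbb R^p$ put $$\mathbf v_h(\mathbf x)=\frac1{(2\pi)^p}\int_{\mathbb R^p}\frac{\phi_{\mathbf w}(\mathbf s)}{\phi_{\mathbf k}(\mathbf s/h)}e^{-i\mathbf s\cdot\mathbf x}\,d\mathbf s,\qquad f_{nh}(\mathbf x)=\frac1{(n-p+1)h^p}\sum_{j=p}^n\mathbf v_h\Big(\frac{\mathbf x-(\log X_j^2,\ldots,\log X_{j-p+1}^2)}h\Big),$$ where $\mathbf v_h$ is real-valued. Then, for every $\mathbf x\in\mathbb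 R^p$, $f_{nh}(\mathbf x)$ is square integrable for all $n\ge p$ and $h>0$, the function $\mathbf u\mapsto\mathbf u^\top\nabla^2f(\mathbf x)\mathbf u\,\mathbf w(\mathbf u)$ is integrable, and, as $h\downarrow0$, uniformly in $n\ge p$, $$\mathrm E f_{nh}(\mathbf x)=f(\mathbf x)+\tfrac12h^2\int_{\mathbb R^p}\mathbf u^\top\nabla^2f(\mathbf x)\mathbf u\,\mathbf w(\mathbf u)\,d\mathbf u+o(h^2)$$ and $$\mathrm{Var} f_{nh}(\mathbf x)=O\Big(\frac1n\big(h^{2\alpha}e^{\pi/h}\big)^p\Big).$$ -/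

import Mathlib

open MeasureTheory ProbabilityTheory Filter Topology Asymptotics

open scoped Matrix

namespace VolDeconv

noncomputable section

/-! ### Fourier transforms, kernels and the estimator -/

/-- The Fourier transform `φ_g(t) = ∫ e^{itu} g(u) du` of a function on the line. -/
def ft (g : ℝ → ℝ) (t : ℝ) : ℂ :=
  ∫ u : ℝ, Complex.exp (Complex.I * ((t * u : ℝ) : ℂ)) * (g u : ℂ)

/-- The Fourier transform `φ_g(s) = ∫ e^{i s·u} g(u) du` of a function on `ℝ^p`. -/
def ftVec {p : ℕ} (g : (Fin p → ℝ) → ℝ) (s : Fin p → ℝ) : ℂ :=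
  ∫ u : Fin p → ℝ, Complex.exp (Complex.I * ((s ⬝ᵥ u : ℝ) : ℂ)) * (g u : ℂ)

/-- The product function `𝐠(x) = ∏ g(x_i)` on `ℝ^p`. -/
def prodKernel (p : ℕ) (g : ℝ → ℝ) (x : Fin p → ℝ) : ℝ := ∏ i, g (x i)

/-- The density of `log Z²` for a standard normal `Z`. -/
def logSqDensity (x : ℝ) : ℝ :=
  1 / Real.sqrt (2 * Real.pi) * Real.exp (x / 2) * Real.exp (-(Real.exp x / 2))

/-- The defining integral of the deconvolution kernel, as a complex number. -/
def deconvKernelC (p : ℕ) (w : ℝ → ℝ) (h : ℝ) (x : Fin p → ℝ) : ℂ :=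
  1 / (2 * Real.pi : ℂ) ^ p *
    ∫ s : Fin p → ℝ,
      ftVec (prodKernel p w) s / ftVec (prodKernel p logSqDensity) (h⁻¹ • s) *
        Complex.exp (-(Complex.I * ((s ⬝ᵥ x : ℝ) : ℂ)))

/-- The deconvolution kernel `𝐯_h`; it is real-valued, see `deconvKernel_ofReal`. -/
def deconvKernel (p : ℕ) (w : ℝ → ℝ) (h : ℝ) (x : Fin p → ℝ) : ℝ :=
  (deconvKernelC p w h x).re

theorem conj_ftVec {p : ℕ} (g : (Fin p → ℝ) → ℝ) (s : Fin p → ℝ) :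
    (starRingEnd ℂ) (ftVec g s) = ftVec g (-s) := by
  unfold ftVec
  rw [← integral_conj]
  congr 1
  funext u
  rw [map_mul, ← Complex.exp_conj, map_mul, Complex.conj_I, Complex.conj_ofReal,
    Complex.conj_ofReal, neg_dotProduct]
  push_cast
  ring_nf

/-- The defining integral of `𝐯_h` is a real number, so taking real parts loses nothing. -/
theorem deconvKernel_ofReal (p : ℕ) (w : ℝ → ℝ) (h : ℝ) (x : Fin p → ℝ) :
    ((deconvKernel p w h x : ℝ) : ℂ) = deconvKernelC p w h x := by
  unfold deconvKernel
  rw [← Complex.conj_eq_iff_re]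
  unfold deconvKernelC
  rw [map_mul, ← integral_conj, ← integral_neg_eq_self]
  congr 1
  · simp [map_pow, map_ofNat]
  · congr 1
    funext s
    rw [map_mul, map_div₀, conj_ftVec, conj_ftVec, ← Complex.exp_conj, map_neg, map_mul,
      Complex.conj_I, Complex.conj_ofReal, smul_neg, neg_neg, neg_neg, neg_dotProduct]
    push_cast
    ring_nf

/-- The vector `(log Y_j², log Y_{j-1}², …, log Y_{j-p+1}²)`. -/
def logSqVec {Ω : Type*} (p : ℕ) (Y : ℤ → Ω → ℝ) (j : ℤ) (ω : Ω) : Fin p → ℝ :=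
  fun i => Real.log (Y (j - (i : ℤ)) ω ^ 2)

/-- The deconvolution density estimator `f_{nh}(x)` based on the observations `X_1, …, X_n`. -/
def estimator {Ω : Type*} (p : ℕ) (w : ℝ → ℝ) (X : ℤ → Ω → ℝ) (n : ℕ) (h : ℝ)
    (x : Fin p → ℝ) (ω : Ω) : ℝ :=
  1 / (((n : ℝ) - p + 1) * h ^ p) *
    ∑ j ∈ Finset.Icc p n, deconvKernel p w h (h⁻¹ • (x - logSqVec p X (j : ℤ) ω))

/-! ### Assumptions -/

/-- The conditions on the kernel function `w`. -/
structure ConditionW (w : ℝ → ℝ) (A α : ℝ) : Prop where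
  symm : ∀ u, w (-u) = w u
  integrable : Integrable w
  integral_eq_one : ∫ u, w u = 1
  integrable_sq : Integrable (fun u => u ^ 2 * w u)
  tendsto_zero : Tendsto w (cocompact ℝ) (𝓝 0)
  support_ft : tsupport (ft w) = Set.Icc (-1) 1
  alpha_pos : 0 < α
  boundary : (fun t : ℝ => ft w (1 - t) - ((A * t ^ α : ℝ) : ℂ)) =o[𝓝[>] 0] fun t : ℝ => t ^ α

/-- Strict stationarity: all time shifts of the process have the same law. -/
def StrictlyStationary {Ω : Type*} [MeasurableSpace Ω] (Y : ℤ → Ω → ℝ) (μ : Measure Ω) : Prop :=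
  ∀ m : ℤ, μ.map (fun ω t => Y (t + m) ω) = μ.map (fun ω t => Y t ω)

/-- The σ-algebra generated by `Y_j`, `j ≤ b`. -/
@[reducible] def sigmaPast {Ω : Type*} (Y : ℤ → Ω → ℝ) (b : ℤ) : MeasurableSpace Ω :=
  ⨆ j : ℤ, ⨆ _ : j ≤ b, MeasurableSpace.comap (Y j) inferInstance

/-- The σ-algebra generated by `Y_j`, `j ≥ a`. -/
@[reducible] def sigmaFuture {Ω : Type*} (Y : ℤ → Ω → ℝ) (a : ℤ) : MeasurableSpace Ω :=
  ⨆ j : ℤ, ⨆ _ : a ≤ j, MeasurableSpace.comap (Y j) inferInstance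

/-- The strong mixing coefficient
`α_k = sup { |P(A ∩ B) - P(A) P(B)| : A ∈ F_{-∞}^0, B ∈ F_k^∞ }`. -/
def mixingCoeff {Ω : Type*} [MeasurableSpace Ω] (Y : ℤ → Ω → ℝ) (μ : Measure Ω) (k : ℕ) : ℝ :=
  sSup {r : ℝ | ∃ A B : Set Ω, MeasurableSet[sigmaPast Y 0] A ∧
    MeasurableSet[sigmaFuture Y (k : ℤ)] B ∧ r = |μ.real (A ∩ B) - μ.real A * μ.real B|}

/-- A process is strongly mixing if its mixing coefficients tend to zero. -/
def StronglyMixing {Ω : Type*} [MeasurableSpace Ω] (Y : ℤ → Ω → ℝ) (μ : Measure Ω) : Prop :=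
  Tendsto (mixingCoeff Y μ) atTop (𝓝 0)

/-- The Hessian matrix of second order partial derivatives. -/
def hessian {p : ℕ} (f : (Fin p → ℝ) → ℝ) (x : Fin p → ℝ) : Matrix (Fin p) (Fin p) ℝ :=
  Matrix.of fun i j => fderiv ℝ (fderiv ℝ f) x (Pi.single i 1) (Pi.single j 1)

end

end VolDeconv

open VolDeconv

/-!
The volatility enters the observations through `log X_t² = log σ_t² + log Z_t²`, and the estimator
is built so that averaging over the noise undoes the convolution: the deconvolution kernel `𝐯_h` is
the product over the coordinates of a one-dimensional kernel `deconvKernelOne`, the inverse Fourier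
transform of `φ_w(s) / φ_k(s/h)`, and since `φ_k` is the characteristic function of `log Z²`
(`integral_gaussian_logSq`), integrating out the independent noise variables multiplies by
`φ_k(s/h)` again and leaves `w` (`ConditionW.integral_deconvKernelOne`). More precisely it leaves
the continuous version `contVersion w` of `w`, which agrees with `w` almost everywhere by Fourier
inversion in `L¹` (`invFt_ft_ae_eq`).

*Bias.* By the above, `E f_{nh}(x) = ∫ f(x - h u) 𝐰(u) du` for every `n`
(`ConditionW.integral_estimator`). A second order Taylor expansion of `f`, in which the linear term
integrates to zero because `w` is symmetric, and dominated convergence for the remainder give the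
expansion (`ConditionW.bias_isLittleO`).

*Variance.* Write the variance of the sum as a double sum of covariances.
For overlapping blocks, at lag less than `p`, the Cauchy-Schwarz inequality reduces to second
moments, which by boundedness of `f` are at most `M h^p ∫ 𝐯_h²`. By Plancherel's identity and the
reflection formula of the Gamma function, which gives `|φ_k(t)|² = 1 / cosh(π t)`,
the integral `∫ 𝐯_h²` is the `p`-th power of a multiple of `∫ |φ_w(s)|² cosh(π s / h) ds`. The mass
of the latter sits within distance `h` of `s = ±1`, where `|φ_w|²` is `O(h^{2α})`; hence it is
`O(h^{1 + 2α} e^{π / h})` (`ConditionW.exists_integral_norm_sq_deconvFt_le`).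
For disjoint blocks the summands are independent conditionally on `σ`, so that their covariance is
the covariance of two bounded functions of the volatilities (`ConditionW.covariance_deconvKernel`).
It is at most a constant times the mixing coefficient of the gap between the blocks
(`abs_covariance_le`), which is summable. The resulting contribution `O(n⁻¹ h^{-2p})` is negligible
because `e^{π / h}` beats every power of `h`.
-/

namespace VolDeconv

/-! ### Fourier inversion and Plancherel on the line -/

section Fourier

open FourierTransform SchwartzMap

theorem integral_fourier_mul {F G : ℝ → ℂ} (hF : Integrable F) (hG : Integrable G) :
    ∫ x, 𝓕 F x * G x = ∫ x, F x * 𝓕 G x := by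
  have := VectorFourier.integral_fourierIntegral_smul_eq_flip (L := innerₗ ℝ)
    Real.continuous_fourierChar continuous_inner hF hG
  rw [flip_innerₗ] at this
  exact this

theorem integral_fourierInv_mul {F G : ℝ → ℂ} (hF : Integrable F) (hG : Integrable G) :
    ∫ x, 𝓕⁻ F x * G x = ∫ x, F x * 𝓕⁻ G x := by
  rw [Real.fourierInv_eq_fourier_comp_neg F, integral_fourier_mul hF.comp_neg hG,
    ← integral_neg_eq_self]
  simp_rw [Real.fourierInv_eq_fourier_neg, neg_neg]

theorem ae_eq_of_integral_mul_schwartz {F G : ℝ → ℂ} (hF : LocallyIntegrable F)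
    (hG : LocallyIntegrable G) (h : ∀ g : 𝓢(ℝ, ℂ), ∫ x, F x * g x = ∫ x, G x * g x) :
    F =ᵐ[volume] G := by
  refine ae_eq_of_integral_contDiff_smul_eq hF hG fun g hg hgs => ?_
  have hg₁ : HasCompactSupport (Complex.ofRealCLM ∘ g) := hgs.comp_left rfl
  have hg₂ : ContDiff ℝ (⊤ : ℕ∞) (Complex.ofRealCLM ∘ g) := by fun_prop
  simpa [mul_comm] using h (hg₁.toSchwartzMap hg₂)

theorem continuous_fourier_real {F : ℝ → ℂ} (hF : Integrable F) : Continuous (𝓕 F) :=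
  VectorFourier.fourierIntegral_continuous Real.continuous_fourierChar continuous_inner hF

/-- Fourier inversion without any continuity assumption; both sides have the same integral against
every Schwartz function. -/
theorem fourier_fourierInv_ae_eq {F : ℝ → ℂ} (hF : Integrable F) (hF' : Integrable (𝓕⁻ F)) :
    𝓕 (𝓕⁻ F) =ᵐ[volume] F := by
  refine ae_eq_of_integral_mul_schwartz (continuous_fourier_real hF').locallyIntegrable
    hF.locallyIntegrable fun g => ?_
  rw [integral_fourier_mul hF' g.integrable, ← SchwartzMap.fourier_coe,
    integral_fourierInv_mul hF (𝓕 g).integrable, ← SchwartzMap.fourierInv_coe,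
    FourierTransform.fourierInv_fourier_eq]

/-- The `L²` Fourier transform, defined by extension from Schwartz functions, is given by the
Fourier integral on `L¹ ∩ L²`. -/
theorem fourier_toLp_ae_eq {F : ℝ → ℂ} (hF : Integrable F) (hF2 : MemLp F 2) :
    (𝓕 (hF2.toLp F) : Lp ℂ 2 (volume : Measure ℝ)) =ᵐ[volume] 𝓕 F := by
  refine ae_eq_of_integral_mul_schwartz ((Lp.memLp _).locallyIntegrable (by norm_num))
    (continuous_fourier_real hF).locallyIntegrable fun g => ?_
  rw [integral_fourier_mul hF g.integrable]
  have h := congrArg (fun T => T g) (Lp.fourier_toTemperedDistribution_eq (hF2.toLp F))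
  simp only [TemperedDistribution.fourier_apply, Lp.toTemperedDistribution_apply, smul_eq_mul] at h
  simp_rw [mul_comm _ (g _)]
  rw [← h, ← SchwartzMap.fourier_coe]
  refine integral_congr_ae ?_
  filter_upwards [hF2.coeFn_toLp] with y hy
  rw [hy, mul_comm]

theorem eLpNorm_fourier {F : ℝ → ℂ} (hF : Integrable F) (hF2 : MemLp F 2) :
    eLpNorm (𝓕 F) 2 = eLpNorm F 2 := by
  rw [← eLpNorm_congr_ae (fourier_toLp_ae_eq hF hF2), ← eLpNorm_congr_ae hF2.coeFn_toLp]
  have := Lp.norm_fourier_eq (hF2.toLp F)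
  rwa [Lp.norm_def, Lp.norm_def, ENNReal.toReal_eq_toReal_iff' (Lp.eLpNorm_ne_top _)
    (Lp.eLpNorm_ne_top _)] at this

/-- The inverse Fourier transform `(2π)⁻¹ ∫ e^{-isx} F(s) ds` in the normalisation matching `ft`. -/
noncomputable def invFt (F : ℝ → ℂ) (x : ℝ) : ℂ :=
  1 / (2 * Real.pi : ℂ) * ∫ s : ℝ, F s * Complex.exp (-(Complex.I * ((s * x : ℝ) : ℂ)))

theorem ft_eq_fourierInv (g : ℝ → ℝ) (t : ℝ) :
    ft g t = 𝓕⁻ (fun u => (g u : ℂ)) (t / (2 * Real.pi)) := by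
  rw [Real.fourierInv_eq', ft]
  congr 1
  funext u
  simp only [smul_eq_mul, RCLike.inner_apply, conj_trivial]
  congr 2
  have : (Real.pi : ℂ) ≠ 0 := by exact_mod_cast Real.pi_ne_zero
  push_cast
  field_simp

theorem invFt_eq_fourier (F : ℝ → ℂ) (x : ℝ) :
    invFt F x = 𝓕 (fun ξ => F (2 * Real.pi * ξ)) x := by
  rw [Real.fourier_eq', invFt]
  have := Measure.integral_comp_mul_left
    (fun s : ℝ => F s * Complex.exp (-(Complex.I * ((s * x : ℝ) : ℂ)))) (2 * Real.pi)
  have h2 : |(2 * Real.pi)⁻¹| = (2 * Real.pi)⁻¹ := abs_of_pos (by positivity)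
  rw [h2] at this
  have h3 : (1 / (2 * Real.pi : ℂ)) = (((2 * Real.pi)⁻¹ : ℝ) : ℂ) := by push_cast; simp
  rw [h3, ← Complex.real_smul, ← this]
  congr 1
  funext u
  simp only [smul_eq_mul, RCLike.inner_apply, conj_trivial]
  rw [mul_comm]
  congr 2
  push_cast
  ring

theorem continuous_ft {g : ℝ → ℝ} (hg : Integrable g) : Continuous (ft g) := by
  have h : Continuous (𝓕⁻ (fun u => (g u : ℂ))) := by
    rw [Real.fourierInv_eq_fourier_comp_neg]
    exact continuous_fourier_real hg.comp_neg.ofReal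
  simp_rw [funext (ft_eq_fourierInv g)]
  fun_prop

theorem continuous_invFt {F : ℝ → ℂ} (hF : Integrable F) : Continuous (invFt F) := by
  rw [funext (invFt_eq_fourier F)]
  exact continuous_fourier_real (hF.comp_mul_left' (by positivity))

theorem norm_invFt_le (F : ℝ → ℂ) (x : ℝ) : ‖invFt F x‖ ≤ 1 / (2 * Real.pi) * ∫ s, ‖F s‖ := by
  rw [invFt, norm_mul]
  refine mul_le_mul (by simp [abs_of_pos Real.pi_pos]) ?_ (norm_nonneg _) (by positivity)
  refine (norm_integral_le_integral_norm _).trans (le_of_eq ?_)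
  congr 1
  funext s
  rw [norm_mul, Complex.norm_exp]
  simp

/-- Fourier inversion in `L¹`; `g` need not be continuous, so equality holds only almost
everywhere. -/
theorem invFt_ft_ae_eq {g : ℝ → ℝ} (hg : Integrable g) (hg' : Integrable (ft g)) :
    invFt (ft g) =ᵐ[volume] fun u => (g u : ℂ) := by
  have h : (fun ξ => ft g (2 * Real.pi * ξ)) = 𝓕⁻ (fun u => (g u : ℂ)) := by
    funext ξ
    rw [ft_eq_fourierInv, mul_div_cancel_left₀ _ (by positivity)]
  rw [funext (invFt_eq_fourier (ft g)), h]
  refine fourier_fourierInv_ae_eq hg.ofReal ?_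
  rw [← h]
  exact hg'.comp_mul_left' (by positivity)

/-- Plancherel's identity for `invFt`. -/
theorem integral_norm_sq_invFt {F : ℝ → ℂ} (hF : Integrable F) (hF2 : MemLp F 2) :
    Integrable (fun x => ‖invFt F x‖ ^ 2) ∧
      ∫ x, ‖invFt F x‖ ^ 2 = 1 / (2 * Real.pi) * ∫ s, ‖F s‖ ^ 2 := by
  set G : ℝ → ℂ := fun ξ => F (2 * Real.pi * ξ) with hG
  have hG1 : Integrable G := hF.comp_mul_left' (by positivity)
  have hsq : Integrable (fun s => ‖F s‖ ^ 2) := (memLp_two_iff_integrable_sq_norm hF2.1).1 hF2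
  have hG2 : MemLp G 2 := by
    rw [memLp_two_iff_integrable_sq_norm hG1.1]
    exact hsq.comp_mul_left' (by positivity)
  have e := eLpNorm_fourier hG1 hG2
  have hFG2 : MemLp (𝓕 G) 2 :=
    ⟨(continuous_fourier_real hG1).aestronglyMeasurable, e ▸ hG2.2⟩
  rw [funext (invFt_eq_fourier F)]
  refine ⟨(memLp_two_iff_integrable_sq_norm hFG2.1).1 hFG2, ?_⟩
  have key : ∫ x, ‖𝓕 G x‖ ^ 2 = ∫ x, ‖G x‖ ^ 2 := by
    have h1 := hFG2.eLpNorm_eq_integral_rpow_norm (by norm_num) (by norm_num)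
    have h2 := hG2.eLpNorm_eq_integral_rpow_norm (by norm_num) (by norm_num)
    rw [e, h2] at h1
    have h3 := (ENNReal.ofReal_eq_ofReal_iff (by positivity) (by positivity)).1 h1
    have h4 := (Real.rpow_left_inj (by positivity) (by positivity) (by norm_num)).1 h3
    simpa using h4.symm
  rw [key]
  have := Measure.integral_comp_mul_left (fun s : ℝ => ‖F s‖ ^ 2) (2 * Real.pi)
  rw [abs_of_pos (by positivity), smul_eq_mul] at this
  rw [one_div, ← this]

theorem conj_ft (g : ℝ → ℝ) (s : ℝ) : (starRingEnd ℂ) (ft g s) = ft g (-s) := by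
  unfold ft
  rw [← integral_conj]
  congr 1
  funext u
  rw [map_mul, ← Complex.exp_conj, map_mul, Complex.conj_I, Complex.conj_ofReal,
    Complex.conj_ofReal, neg_mul]
  push_cast
  ring_nf

theorem ofReal_re_invFt {F : ℝ → ℂ} (hF : ∀ s, (starRingEnd ℂ) (F s) = F (-s)) (x : ℝ) :
    (((invFt F x).re : ℝ) : ℂ) = invFt F x := by
  rw [← Complex.conj_eq_iff_re]
  unfold invFt
  rw [map_mul, ← integral_conj, ← integral_neg_eq_self]
  congr 1
  · simp [map_ofNat]
  · congr 1
    funext s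
    rw [map_mul, hF, ← Complex.exp_conj, map_neg, map_mul,
      Complex.conj_I, Complex.conj_ofReal, neg_neg]
    push_cast
    ring_nf

end Fourier

/-! ### The characteristic function of `log Z²` -/

/-- The integrand of the Gamma integral to which both `ft logSqDensity` and the characteristic
function of `log Z²` reduce by substitution. -/
noncomputable def gammaIntegrand (t y : ℝ) : ℂ :=
  Complex.exp (Complex.I * ((t * Real.log y : ℝ) : ℂ)) *
    ((y ^ (-(1 / 2) : ℝ) * Real.exp (-(y / 2)) : ℝ) : ℂ)

theorem ft_logSqDensity_eq_integral (t : ℝ) :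
    ft logSqDensity t = ((1 / Real.sqrt (2 * Real.pi) : ℝ) : ℂ) *
      ∫ y in Set.Ioi (0 : ℝ), gammaIntegrand t y := by
  have h := integral_image_eq_integral_abs_deriv_smul (s := Set.univ) (f := Real.exp)
    (f' := Real.exp) MeasurableSet.univ (fun x _ => (Real.hasDerivAt_exp x).hasDerivWithinAt)
    (Real.exp_injective.injOn) (gammaIntegrand t)
  rw [Set.image_univ, Real.range_exp] at h
  rw [h, ft, setIntegral_univ, ← integral_const_mul]
  congr 1
  funext u
  have e : Real.exp u * Real.exp u ^ (-(1 / 2) : ℝ) = Real.exp (u / 2) := by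
    rw [← Real.exp_mul, ← Real.exp_add]
    ring_nf
  rw [gammaIntegrand, logSqDensity, Real.log_exp, abs_of_pos (Real.exp_pos u), Complex.real_smul,
    ← e]
  push_cast
  ring

theorem integral_even {f : ℝ → ℂ} (hf : Integrable f) (h : ∀ x, f (-x) = f x) :
    ∫ x, f x = 2 * ∫ x in Set.Ioi (0 : ℝ), f x := by
  rw [← integral_add_compl measurableSet_Ioi hf, Set.compl_Ioi, two_mul]
  have := integral_comp_neg_Ioi (0 : ℝ) f
  simp only [h, neg_zero] at this
  rw [← this]

/-- The characteristic function of `log Z²` is the Fourier transform of `logSqDensity`. At the null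
point `z = 0` the integrand takes the junk value coming from `Real.log 0 = 0`. -/
theorem integral_gaussian_logSq (t : ℝ) :
    ∫ z, Complex.exp (Complex.I * ((t * Real.log (z ^ 2) : ℝ) : ℂ)) ∂(gaussianReal 0 1) =
      ft logSqDensity t := by
  rw [integral_gaussianReal_eq_integral_smul one_ne_zero, ft_logSqDensity_eq_integral]
  have hint : Integrable fun z : ℝ => gaussianPDFReal 0 1 z •
      Complex.exp (Complex.I * ((t * Real.log (z ^ 2) : ℝ) : ℂ)) := by
    refine (integrable_gaussianPDFReal 0 1).smul_of_top_left ?_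
    refine memLp_top_of_bound (by measurability) 1 (ae_of_all _ fun z => ?_)
    rw [mul_comm, Complex.norm_exp_ofReal_mul_I]
  -- fold the integral to `(0, ∞)`, then substitute `y = z²`
  have h1 := integral_even hint fun z => by simp [gaussianPDFReal]
  have h2 := integral_comp_rpow_Ioi_of_pos (g := gammaIntegrand t) (p := 2) (by norm_num)
  rw [h1, ← h2, ← integral_const_mul, ← integral_const_mul]
  refine setIntegral_congr_fun measurableSet_Ioi fun z (hz : 0 < z) => ?_
  have e : (2 * z ^ ((2 : ℝ) - 1)) * ((z ^ (2 : ℝ)) ^ (-(1 / 2) : ℝ)) = 2 := by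
    rw [← Real.rpow_mul hz.le, mul_assoc, ← Real.rpow_add hz]
    norm_num
  have e2 : z ^ (2 : ℝ) = z ^ 2 := by norm_cast
  simp only [gammaIntegrand, gaussianPDFReal, Complex.real_smul]
  have e3 : ((2 * z ^ ((2 : ℝ) - 1) : ℝ) : ℂ) * (((z ^ (2 : ℝ)) ^ (-(1 / 2) : ℝ) : ℝ) : ℂ) = 2 := by
    exact_mod_cast e
  have e4 : -((z - 0) ^ 2) / (2 * ((1 : NNReal) : ℝ)) = -(z ^ 2 / 2) := by
    push_cast; ring
  rw [e4, e2] at *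
  simp only [NNReal.coe_one, mul_one, one_div] at *
  rw [Complex.ofReal_mul, Complex.ofReal_mul ((z ^ 2) ^ _)]
  linear_combination (-((Real.sqrt (2 * Real.pi))⁻¹ : ℝ) *
    Complex.exp (Complex.I * ((t * Real.log (z ^ 2) : ℝ) : ℂ)) *
    ((Real.exp (-(z ^ 2 / 2)) : ℝ) : ℂ)) * e3

theorem ft_logSqDensity_eq_Gamma (t : ℝ) :
    ft logSqDensity t = ((1 / Real.sqrt (2 * Real.pi) : ℝ) : ℂ) *
      ((2 : ℂ) ^ (1 / 2 + t * Complex.I) * Complex.Gamma (1 / 2 + t * Complex.I)) := by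
  rw [ft_logSqDensity_eq_integral]
  congr 1
  have h := Complex.integral_cpow_mul_exp_neg_mul_Ioi (a := 1 / 2 + t * Complex.I)
    (r := 1 / 2) (by simp) (by norm_num)
  rw [show (1 / ((1 / 2 : ℝ) : ℂ)) = 2 by push_cast; norm_num] at h
  rw [← h]
  refine setIntegral_congr_fun measurableSet_Ioi fun y (hy : 0 < y) => ?_
  have hy' : (y : ℂ) ≠ 0 := by exact_mod_cast hy.ne'
  simp only [gammaIntegrand]
  rw [Complex.cpow_def_of_ne_zero hy', Real.rpow_def_of_pos hy, ← Complex.ofReal_log hy.le]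
  push_cast
  rw [← Complex.exp_add, ← Complex.exp_add, ← Complex.exp_add]
  ring_nf

/-- Euler's reflection formula on the line `Re s = 1/2`, where `1 - s` is the conjugate of `s`. -/
theorem norm_sq_Gamma_half_add (t : ℝ) :
    ‖Complex.Gamma (1 / 2 + t * Complex.I)‖ ^ 2 = Real.pi / Real.cosh (Real.pi * t) := by
  have h := Complex.Gamma_mul_Gamma_one_sub (1 / 2 + t * Complex.I)
  have hc : (1 : ℂ) - (1 / 2 + t * Complex.I) = (starRingEnd ℂ) (1 / 2 + t * Complex.I) := by
    rw [map_add, map_mul, Complex.conj_I, Complex.conj_ofReal, map_div₀, map_one, map_ofNat]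
    ring
  have hs : Complex.sin (Real.pi * (1 / 2 + t * Complex.I)) = Complex.cosh (Real.pi * t) := by
    rw [← Complex.cos_mul_I, ← Complex.cos_pi_div_two_sub, ← Complex.cos_neg]
    congr 1
    ring
  rw [hc, Complex.Gamma_conj, Complex.mul_conj', hs] at h
  exact_mod_cast h

theorem norm_sq_ft_logSqDensity (t : ℝ) :
    ‖ft logSqDensity t‖ ^ 2 = 1 / Real.cosh (Real.pi * t) := by
  rw [ft_logSqDensity_eq_Gamma, norm_mul, norm_mul, mul_pow, mul_pow, norm_sq_Gamma_half_add]
  have h2 : ‖(2 : ℂ) ^ (1 / 2 + t * Complex.I : ℂ)‖ = Real.sqrt 2 := by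
    have := Complex.norm_cpow_eq_rpow_re_of_pos (x := 2) (by norm_num) (1 / 2 + t * Complex.I)
    rw [Real.sqrt_eq_rpow]
    simpa using this
  rw [h2, Complex.norm_real, Real.norm_eq_abs, sq_abs, div_pow, Real.sq_sqrt (by positivity),
    Real.sq_sqrt (by positivity)]
  have := Real.cosh_pos (Real.pi * t)
  have := Real.pi_pos
  field_simp

theorem ft_logSqDensity_ne_zero (t : ℝ) : ft logSqDensity t ≠ 0 := by
  intro h
  have := norm_sq_ft_logSqDensity t
  rw [h] at this
  have h2 := Real.cosh_pos (Real.pi * t)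
  have : 0 < 1 / Real.cosh (Real.pi * t) := by positivity
  simp_all

theorem integrable_logSqDensity : Integrable logSqDensity := by
  -- otherwise the Fourier transform would vanish at the origin
  by_contra h
  apply ft_logSqDensity_ne_zero 0
  rw [ft]
  refine integral_undef fun h2 => h ?_
  simpa using h2.re

theorem continuous_ft_logSqDensity : Continuous (ft logSqDensity) :=
  continuous_ft integrable_logSqDensity

/-! ### The one-dimensional deconvolution kernel -/

/-- The Fourier transform `s ↦ φ_w(s) / φ_k(s/h)` of the one-dimensional deconvolution kernel. -/
noncomputable def deconvFt (w : ℝ → ℝ) (h s : ℝ) : ℂ := ft w s / ft logSqDensity (h⁻¹ * s)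

/-- The one-dimensional deconvolution kernel; `deconvKernel` is its product over the
coordinates. -/
noncomputable def deconvKernelOne (w : ℝ → ℝ) (h y : ℝ) : ℝ := (invFt (deconvFt w h) y).re

/-- The continuous version `(2π)⁻¹ ∫ φ_w(s) e^{-isu} ds` of the kernel `w`. -/
noncomputable def contVersion (w : ℝ → ℝ) (u : ℝ) : ℝ := (invFt (ft w) u).re

theorem ofReal_deconvKernelOne (w : ℝ → ℝ) (h y : ℝ) :
    (deconvKernelOne w h y : ℂ) = invFt (deconvFt w h) y := by
  refine ofReal_re_invFt (fun s => ?_) y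
  rw [deconvFt, map_div₀, conj_ft, conj_ft, deconvFt, mul_neg]

theorem ofReal_contVersion (w : ℝ → ℝ) (u : ℝ) : (contVersion w u : ℂ) = invFt (ft w) u :=
  ofReal_re_invFt (conj_ft w) u

theorem ftVec_prodKernel {p : ℕ} (g : ℝ → ℝ) (s : Fin p → ℝ) :
    ftVec (prodKernel p g) s = ∏ i, ft g (s i) := by
  unfold ft
  rw [ftVec, ← integral_fintype_prod_volume_eq_prod]
  congr 1
  funext u
  rw [Finset.prod_mul_distrib, ← Complex.exp_sum, prodKernel, dotProduct]
  push_cast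
  rw [Finset.mul_sum]

theorem deconvKernel_eq_prod (p : ℕ) (w : ℝ → ℝ) (h : ℝ) (y : Fin p → ℝ) :
    deconvKernel p w h y = ∏ i, deconvKernelOne w h (y i) := by
  have : ((deconvKernel p w h y : ℝ) : ℂ) = ((∏ i, deconvKernelOne w h (y i) : ℝ) : ℂ) := by
    rw [deconvKernel_ofReal]
    push_cast
    simp_rw [ofReal_deconvKernelOne]
    unfold invFt
    rw [Finset.prod_mul_distrib, ← integral_fintype_prod_volume_eq_prod, deconvKernelC,
      Finset.prod_const, Finset.card_univ, Fintype.card_fin, div_pow, one_pow]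
    congr 2
    funext s
    rw [ftVec_prodKernel, ftVec_prodKernel, Finset.prod_mul_distrib, ← Complex.exp_sum,
      ← Finset.prod_div_distrib, dotProduct]
    push_cast
    rw [Finset.mul_sum, Finset.sum_neg_distrib]
    rfl
  exact_mod_cast this

section ConditionW

variable {w : ℝ → ℝ} {A α : ℝ}

theorem ConditionW.ft_eq_zero (hw : ConditionW w A α) {s : ℝ} (hs : s ∉ Set.Icc (-1 : ℝ) 1) :
    ft w s = 0 := by
  rw [← hw.support_ft] at hs
  exact image_eq_zero_of_notMem_tsupport hs

theorem ConditionW.hasCompactSupport_ft (hw : ConditionW w A α) : HasCompactSupport (ft w) := by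
  rw [HasCompactSupport, hw.support_ft]
  exact isCompact_Icc

theorem ConditionW.integrable_ft (hw : ConditionW w A α) : Integrable (ft w) :=
  (continuous_ft hw.integrable).integrable_of_hasCompactSupport hw.hasCompactSupport_ft

theorem ConditionW.continuous_deconvFt (hw : ConditionW w A α) (h : ℝ) :
    Continuous (deconvFt w h) := by
  refine (continuous_ft hw.integrable).div (continuous_ft_logSqDensity.comp (by fun_prop)) ?_
  exact fun s => ft_logSqDensity_ne_zero _

theorem ConditionW.hasCompactSupport_deconvFt (hw : ConditionW w A α) (h : ℝ) :
    HasCompactSupport (deconvFt w h) := by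
  refine hw.hasCompactSupport_ft.mono fun s hs => ?_
  contrapose! hs
  simp only [Function.mem_support, not_not] at hs ⊢
  rw [deconvFt, hs, zero_div]

theorem ConditionW.integrable_deconvFt (hw : ConditionW w A α) (h : ℝ) :
    Integrable (deconvFt w h) :=
  (hw.continuous_deconvFt h).integrable_of_hasCompactSupport (hw.hasCompactSupport_deconvFt h)

theorem ConditionW.memLp_deconvFt (hw : ConditionW w A α) (h : ℝ) :
    MemLp (deconvFt w h) 2 :=
  (hw.continuous_deconvFt h).memLp_of_hasCompactSupport (hw.hasCompactSupport_deconvFt h)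

theorem ConditionW.continuous_deconvKernelOne (hw : ConditionW w A α) (h : ℝ) :
    Continuous (deconvKernelOne w h) :=
  Complex.continuous_re.comp (continuous_invFt (hw.integrable_deconvFt h))

theorem ConditionW.continuous_contVersion (hw : ConditionW w A α) : Continuous (contVersion w) :=
  Complex.continuous_re.comp (continuous_invFt hw.integrable_ft)

theorem ConditionW.contVersion_ae_eq (hw : ConditionW w A α) : contVersion w =ᵐ[volume] w := by
  filter_upwards [invFt_ft_ae_eq hw.integrable hw.integrable_ft] with u hu
  rw [contVersion, hu, Complex.ofReal_re]

theorem exists_abs_deconvKernelOne_le (w : ℝ → ℝ) (h : ℝ) :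
    ∃ b, ∀ y, |deconvKernelOne w h y| ≤ b :=
  ⟨_, fun y => (Complex.abs_re_le_norm _).trans (norm_invFt_le _ y)⟩

theorem exists_abs_contVersion_le (w : ℝ → ℝ) : ∃ b, ∀ u, |contVersion w u| ≤ b :=
  ⟨_, fun y => (Complex.abs_re_le_norm _).trans (norm_invFt_le _ y)⟩

/-- The boundary behaviour of `φ_w` at `1` extends to an upper bound on `[0, 1)`. -/
theorem ConditionW.exists_norm_ft_le (hw : ConditionW w A α) :
    ∃ C, 0 ≤ C ∧ ∀ t, 0 < t → t ≤ 1 → ‖ft w (1 - t)‖ ≤ C * t ^ α := by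
  have h1 : (fun t : ℝ => ft w (1 - t)) =O[𝓝[>] 0] fun t : ℝ => t ^ α := by
    have h2 : (fun t : ℝ => ((A * t ^ α : ℝ) : ℂ)) =O[𝓝[>] 0] fun t : ℝ => t ^ α := by
      refine IsBigO.of_bound |A| (Eventually.of_forall fun t => ?_)
      rw [Complex.norm_real, norm_mul, Real.norm_eq_abs A]
    simpa using hw.boundary.isBigO.add h2
  obtain ⟨c, hc⟩ := h1.bound
  obtain ⟨δ, hδ, hδc⟩ := mem_nhdsGT_iff_exists_Ioo_subset.1 hc
  have hδ : 0 < δ := hδ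
  set K := ∫ u, |w u| with hK
  have hK0 : 0 ≤ K := integral_nonneg fun _ => abs_nonneg _
  have hKb : ∀ s, ‖ft w s‖ ≤ K := by
    intro s
    rw [ft]
    refine (norm_integral_le_integral_norm _).trans (le_of_eq ?_)
    congr 1
    funext u
    rw [norm_mul, mul_comm Complex.I, Complex.norm_exp_ofReal_mul_I, one_mul, Complex.norm_real,
      Real.norm_eq_abs]
  have hδα : 0 < δ ^ α := Real.rpow_pos_of_pos hδ _
  -- the first constant serves `t < δ`, the second one `δ ≤ t`, where `φ_w` is bounded by `K`
  refine ⟨|c| + K / δ ^ α, by positivity, fun t ht _ => ?_⟩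
  have htα : 0 < t ^ α := Real.rpow_pos_of_pos ht _
  rw [add_mul]
  rcases lt_or_ge t δ with h | h
  · have h3 : ‖ft w (1 - t)‖ ≤ c * ‖t ^ α‖ := hδc ⟨ht, h⟩
    rw [Real.norm_of_nonneg htα.le] at h3
    have h4 : c * t ^ α ≤ |c| * t ^ α := by gcongr; exact le_abs_self c
    have h5 : 0 ≤ K / δ ^ α * t ^ α := by positivity
    linarith
  · have h3 : δ ^ α ≤ t ^ α := Real.rpow_le_rpow hδ.le h hw.alpha_pos.le
    have h4 : K ≤ K / δ ^ α * t ^ α := by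
      rw [div_mul_eq_mul_div, le_div_iff₀ hδα]
      gcongr
    have h5 : 0 ≤ |c| * t ^ α := by positivity
    linarith [hKb (1 - t)]

theorem norm_sq_deconvFt (w : ℝ → ℝ) (h s : ℝ) :
    ‖deconvFt w h s‖ ^ 2 = ‖ft w s‖ ^ 2 * Real.cosh (Real.pi * (h⁻¹ * s)) := by
  rw [deconvFt, norm_div, div_pow, norm_sq_ft_logSqDensity, div_div_eq_mul_div, div_one]

theorem norm_deconvFt_neg (w : ℝ → ℝ) (h s : ℝ) : ‖deconvFt w h (-s)‖ = ‖deconvFt w h s‖ := by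
  rw [deconvFt, mul_neg, ← conj_ft, ← conj_ft, ← map_div₀, RCLike.norm_conj, deconvFt]

theorem cosh_le_exp {x : ℝ} (hx : 0 ≤ x) : Real.cosh x ≤ Real.exp x := by
  rw [Real.cosh_eq]
  have : Real.exp (-x) ≤ Real.exp x := Real.exp_le_exp.2 (by linarith)
  linarith

/-- The `L²` norm of `φ_w(s) / φ_k(s/h)` is dominated by the endpoints `s = ±1`: there
`|φ_k(s/h)|⁻² = cosh(πs/h)` has size `e^{π/h}`, and it decays on the scale `h` away from them, on
which `|φ_w|²` is of order `h^{2α}`. -/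
theorem ConditionW.exists_integral_norm_sq_deconvFt_le (hw : ConditionW w A α) :
    ∃ C, 0 ≤ C ∧ ∀ h, 0 < h →
      ∫ s, ‖deconvFt w h s‖ ^ 2 ≤ C * (h * (h ^ (2 * α) * Real.exp (Real.pi / h))) := by
  obtain ⟨C, hC, hCb⟩ := hw.exists_norm_ft_le
  have hα := hw.alpha_pos
  refine ⟨2 * C ^ 2 * (Real.pi⁻¹ ^ (2 * α + 1) * Real.Gamma (2 * α + 1)), ?_, fun h hh => ?_⟩
  · have := Real.Gamma_pos_of_pos (show 0 < 2 * α + 1 by linarith)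
    have := Real.pi_pos
    positivity
  set r := Real.pi / h with hr
  have hr0 : 0 < r := by positivity
  set g₀ : ℝ → ℝ := fun t => C ^ 2 * Real.exp r * (t ^ (2 * α + 1 - 1) * Real.exp (-(r * t)))
    with hg₀
  set g := (Set.Ioi (0 : ℝ)).indicator g₀ with hg
  have hg_nonneg : ∀ t, 0 ≤ g t := fun t => by
    refine Set.indicator_nonneg (fun t (ht : 0 < t) => ?_) t
    simp only [hg₀]
    positivity
  have hint0 : ∫ t in Set.Ioi (0 : ℝ), t ^ (2 * α + 1 - 1) * Real.exp (-(r * t)) =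
      (1 / r) ^ (2 * α + 1) * Real.Gamma (2 * α + 1) :=
    Real.integral_rpow_mul_exp_neg_mul_Ioi (by linarith) hr0
  have hint1 : IntegrableOn (fun t : ℝ => t ^ (2 * α + 1 - 1) * Real.exp (-(r * t)))
      (Set.Ioi 0) := by
    refine Integrable.of_integral_ne_zero ?_
    rw [hint0]
    have := Real.Gamma_pos_of_pos (show 0 < 2 * α + 1 by linarith)
    positivity
  have hgi : Integrable g := (integrable_indicator_iff measurableSet_Ioi).2 (hint1.const_mul _)
  have hgv : ∫ t, g t = C ^ 2 * Real.exp r * ((1 / r) ^ (2 * α + 1) * Real.Gamma (2 * α + 1)) := by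
    rw [hg, integral_indicator measurableSet_Ioi, ← hint0, ← integral_const_mul]
  have hpt : ∀ s, 0 ≤ s → s < 1 → ‖deconvFt w h s‖ ^ 2 ≤ g (1 - s) := by
    intro s hs0 hs1
    have ht : 0 < 1 - s := by linarith
    have h1 := hCb (1 - s) ht (by linarith)
    rw [sub_sub_cancel] at h1
    rw [norm_sq_deconvFt, hg, Set.indicator_of_mem (show 1 - s ∈ Set.Ioi (0 : ℝ) from ht)]
    simp only [hg₀]
    calc ‖ft w s‖ ^ 2 * Real.cosh (Real.pi * (h⁻¹ * s))
        ≤ (C * (1 - s) ^ α) ^ 2 * Real.exp (Real.pi * (h⁻¹ * s)) := by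
          gcongr
          exact cosh_le_exp (by positivity)
      _ = _ := by
          have e1 : ((1 - s) ^ α) ^ 2 = (1 - s) ^ (2 * α + 1 - 1) := by
            rw [← Real.rpow_natCast, ← Real.rpow_mul ht.le]
            congr 1
            push_cast
            ring
          have e2 : Real.exp (Real.pi * (h⁻¹ * s)) = Real.exp r * Real.exp (-(r * (1 - s))) := by
            rw [← Real.exp_add]
            congr 1
            rw [hr]
            ring
          rw [mul_pow, e1, e2]
          ring
  -- `hpt` does not cover the points `s = ±1`, which form a null set
  have hae : ∀ᵐ s : ℝ, ‖deconvFt w h s‖ ^ 2 ≤ g (1 - s) + g (1 + s) := by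
    filter_upwards [compl_mem_ae_iff.2 (measure_singleton (1 : ℝ)),
      compl_mem_ae_iff.2 (measure_singleton (-1 : ℝ))] with s hs1 hs2
    have hs1 : s ≠ 1 := hs1
    have hs2 : s ≠ -1 := hs2
    by_cases hs : s ∈ Set.Icc (-1 : ℝ) 1
    · have l1 := hg_nonneg (1 - s)
      have l2 := hg_nonneg (1 + s)
      rcases le_total 0 s with h0 | h0
      · linarith [hpt s h0 (lt_of_le_of_ne hs.2 hs1)]
      · have h3 := hpt (-s) (by linarith) (by linarith [lt_of_le_of_ne hs.1 hs2.symm])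
        rw [norm_deconvFt_neg, sub_neg_eq_add] at h3
        linarith
    · rw [deconvFt, hw.ft_eq_zero hs]
      simpa using add_nonneg (hg_nonneg (1 - s)) (hg_nonneg (1 + s))
  have hg1 : Integrable fun s => g (1 - s) := hgi.comp_sub_left 1
  have hg2 : Integrable fun s => g (1 + s) := hgi.comp_add_left 1
  have := integral_mono_of_nonneg (ae_of_all _ fun s => by positivity) (hg1.add hg2) hae
  refine this.trans (le_of_eq ?_)
  rw [integral_add' hg1 hg2, integral_sub_left_eq_self g volume 1, integral_add_left_eq_self g 1,
    hgv]
  have e3 : (1 / r) ^ (2 * α + 1) = Real.pi⁻¹ ^ (2 * α + 1) * (h * h ^ (2 * α)) := by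
    rw [hr, one_div_div, div_eq_inv_mul, Real.mul_rpow (by positivity) hh.le,
      Real.rpow_add_one hh.ne' (2 * α)]
    ring
  rw [e3]
  ring

theorem ConditionW.integrable_sq_deconvKernelOne (hw : ConditionW w A α) (h : ℝ) :
    Integrable fun y => deconvKernelOne w h y ^ 2 := by
  have := (integral_norm_sq_invFt (hw.integrable_deconvFt h) (hw.memLp_deconvFt h)).1
  refine this.congr (ae_of_all _ fun y => ?_)
  dsimp only
  rw [← ofReal_deconvKernelOne, Complex.norm_real, Real.norm_eq_abs, sq_abs]

theorem ConditionW.exists_integral_sq_deconvKernelOne_le (hw : ConditionW w A α) :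
    ∃ C, 0 ≤ C ∧ ∀ h, 0 < h →
      ∫ y, deconvKernelOne w h y ^ 2 ≤ C * (h * (h ^ (2 * α) * Real.exp (Real.pi / h))) := by
  obtain ⟨C, hC, hCb⟩ := hw.exists_integral_norm_sq_deconvFt_le
  refine ⟨1 / (2 * Real.pi) * C, by positivity, fun h hh => ?_⟩
  have := (integral_norm_sq_invFt (hw.integrable_deconvFt h) (hw.memLp_deconvFt h)).2
  simp_rw [← ofReal_deconvKernelOne, Complex.norm_real, Real.norm_eq_abs, sq_abs] at this
  rw [this, mul_assoc]
  exact mul_le_mul_of_nonneg_left (hCb h hh) (by positivity)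

end ConditionW

/-! ### The covariance inequality for strongly mixing processes -/

/-- If the integrals of `V` over all sets of a sub-σ-algebra `m` are small, then so is the
integral of `V` against any bounded `m`-measurable function: replacing `V` by `D = E[V | m]`, the
latter is at most `a E|D|`, and `E|D|` is the difference of the integrals of `V` over `{0 ≤ D}` and
its complement. -/
theorem abs_integral_mul_le_of_abs_setIntegral_le {Ω : Type*} {m m₀ : MeasurableSpace Ω}
    {μ : Measure Ω} [IsProbabilityMeasure μ] (hm : m ≤ m₀) {U V : Ω → ℝ} {a c : ℝ}
    (hU : Measurable[m] U) (hUa : ∀ ω, |U ω| ≤ a) (hV : Integrable V μ)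
    (hc : ∀ S, MeasurableSet[m] S → |∫ ω in S, V ω ∂μ| ≤ c) :
    |∫ ω, U ω * V ω ∂μ| ≤ 2 * a * c := by
  have hΩ : Nonempty Ω := nonempty_of_isProbabilityMeasure μ
  have ha : 0 ≤ a := (abs_nonneg _).trans (hUa hΩ.some)
  set D := μ[V | m] with hD
  have hDm : StronglyMeasurable[m] D := stronglyMeasurable_condExp
  have hDi : Integrable D μ := integrable_condExp
  have hUV : Integrable (fun ω => U ω * V ω) μ :=
    hV.bdd_mul (hU.mono hm le_rfl).aestronglyMeasurable (ae_of_all _ hUa)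
  have h1 : ∫ ω, U ω * V ω ∂μ = ∫ ω, U ω * D ω ∂μ := by
    rw [← integral_condExp hm]
    exact integral_congr_ae (condExp_mul_of_stronglyMeasurable_left hU.stronglyMeasurable hUV hV)
  set S : Set Ω := {ω | 0 ≤ D ω} with hS
  have hSm : MeasurableSet[m] S := measurableSet_le (@measurable_const _ _ _ m _) hDm.measurable
  have h2 : ∫ ω, |D ω| ∂μ = (∫ ω in S, V ω ∂μ) - ∫ ω in Sᶜ, V ω ∂μ := by
    rw [← setIntegral_condExp hm hV hSm, ← setIntegral_condExp hm hV hSm.compl,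
      ← integral_add_compl (hm _ hSm) hDi.abs, sub_eq_add_neg]
    have e : -∫ ω in Sᶜ, D ω ∂μ = ∫ ω in Sᶜ, -D ω ∂μ := (integral_neg _).symm
    rw [e]
    congr 1
    · exact setIntegral_congr_fun (hm _ hSm) fun ω (hω : 0 ≤ D ω) => abs_of_nonneg hω
    · exact setIntegral_congr_fun (hm _ hSm.compl) fun ω hω => abs_of_neg (not_le.1 hω)
  calc |∫ ω, U ω * V ω ∂μ| ≤ ∫ ω, a * |D ω| ∂μ := by
        rw [h1, ← Real.norm_eq_abs]
        refine norm_integral_le_of_norm_le (hDi.abs.const_mul a) (ae_of_all _ fun ω => ?_)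
        rw [norm_mul]
        exact mul_le_mul_of_nonneg_right (hUa ω) (norm_nonneg _)
    _ = a * ((∫ ω in S, V ω ∂μ) - ∫ ω in Sᶜ, V ω ∂μ) := by rw [integral_const_mul, h2]
    _ ≤ a * (c + c) := by
        have := abs_le.1 (hc S hSm)
        have := abs_le.1 (hc Sᶜ hSm.compl)
        gcongr
        linarith
    _ = 2 * a * c := by ring

/-- The covariance inequality for bounded random variables. It follows by applying
`abs_integral_mul_le_of_abs_setIntegral_le` twice: to `V` and the centred indicator of a fixed set
of `m₁`, and then to `U` and the centred `V`. -/
theorem abs_covariance_le {Ω : Type*} {m₁ m₂ m₀ : MeasurableSpace Ω}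
    {μ : Measure Ω} [IsProbabilityMeasure μ] (hm₁ : m₁ ≤ m₀) (hm₂ : m₂ ≤ m₀) {U V : Ω → ℝ}
    {a b c : ℝ} (hU : Measurable[m₁] U) (hUa : ∀ ω, |U ω| ≤ a) (hV : Measurable[m₂] V)
    (hVb : ∀ ω, |V ω| ≤ b)
    (hc : ∀ A B, MeasurableSet[m₁] A → MeasurableSet[m₂] B →
      |μ.real (A ∩ B) - μ.real A * μ.real B| ≤ c) :
    |cov[U, V; μ]| ≤ 4 * a * b * c := by
  have hVi : Integrable V μ :=
    Integrable.of_bound (hV.mono hm₂ le_rfl).aestronglyMeasurable b (ae_of_all _ hVb)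
  have hUi : Integrable U μ :=
    Integrable.of_bound (hU.mono hm₁ le_rfl).aestronglyMeasurable a (ae_of_all _ hUa)
  have h1 : cov[U, V; μ] = ∫ ω, U ω * (V ω - ∫ x, V x ∂μ) ∂μ := by
    have hVc : Integrable (fun ω => V ω - ∫ x, V x ∂μ) μ := hVi.sub (integrable_const _)
    have hUV : Integrable (fun ω => U ω * (V ω - ∫ x, V x ∂μ)) μ :=
      hVc.bdd_mul hUi.1 (ae_of_all _ hUa)
    have h0 : ∫ ω, (V ω - ∫ x, V x ∂μ) ∂μ = 0 := by
      rw [integral_sub hVi (integrable_const _)]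
      simp
    simp_rw [covariance, sub_mul]
    rw [integral_sub hUV (hVc.const_mul _), integral_const_mul, h0, mul_zero, sub_zero]
  rw [h1, show 4 * a * b * c = 2 * a * (2 * b * c) by ring]
  refine abs_integral_mul_le_of_abs_setIntegral_le hm₁ hU hUa (hVi.sub (integrable_const _))
    fun A hA => ?_
  have h2 : ∫ ω in A, (V ω - ∫ x, V x ∂μ) ∂μ =
      ∫ ω, V ω * (A.indicator 1 ω - μ.real A) ∂μ := by
    have hi : Integrable (A.indicator (1 : Ω → ℝ)) μ :=
      (integrable_const (1 : ℝ)).indicator (hm₁ _ hA)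
    have e : ∀ ω, V ω * (A.indicator 1 ω - μ.real A) = A.indicator V ω - V ω * μ.real A := by
      intro ω
      by_cases h : ω ∈ A <;> simp [h, mul_sub]
    simp_rw [e]
    rw [integral_sub hVi.integrableOn (integrable_const _), setIntegral_const,
      integral_sub (hVi.indicator (hm₁ _ hA)) (hVi.mul_const _), integral_indicator (hm₁ _ hA),
      integral_mul_const, smul_eq_mul, mul_comm]
  have hi : Integrable (A.indicator (1 : Ω → ℝ)) μ :=
    (integrable_const (1 : ℝ)).indicator (hm₁ _ hA)
  rw [h2]
  refine abs_integral_mul_le_of_abs_setIntegral_le hm₂ hV hVb (hi.sub (integrable_const _))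
    fun B hB => ?_
  rw [integral_sub hi.integrableOn (integrable_const _), setIntegral_const,
    setIntegral_indicator (hm₁ _ hA)]
  convert hc A B hA hB using 2
  simp [Set.inter_comm, mul_comm]

theorem one_mem_upperBounds_mixingCoeff {Ω : Type*} [MeasurableSpace Ω] (Y : ℤ → Ω → ℝ)
    (μ : Measure Ω) [IsProbabilityMeasure μ] (k : ℕ) :
    1 ∈ upperBounds {r : ℝ | ∃ A B : Set Ω, MeasurableSet[sigmaPast Y 0] A ∧
      MeasurableSet[sigmaFuture Y (k : ℤ)] B ∧ r = |μ.real (A ∩ B) - μ.real A * μ.real B|} := by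
  rintro r ⟨A, B, -, -, rfl⟩
  have h1 : μ.real (A ∩ B) ≤ 1 := measureReal_le_one
  have h2 : μ.real A ≤ 1 := measureReal_le_one
  have h3 : μ.real B ≤ 1 := measureReal_le_one
  have h4 : 0 ≤ μ.real (A ∩ B) := measureReal_nonneg
  have h5 : 0 ≤ μ.real A := measureReal_nonneg
  have h6 : 0 ≤ μ.real B := measureReal_nonneg
  rw [abs_le]
  constructor <;> nlinarith

theorem mixingCoeff_nonneg {Ω : Type*} [MeasurableSpace Ω] (Y : ℤ → Ω → ℝ) (μ : Measure Ω)
    (k : ℕ) : 0 ≤ mixingCoeff Y μ k := by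
  refine Real.sSup_nonneg ?_
  rintro r ⟨A, B, -, -, rfl⟩
  exact abs_nonneg _

theorem mixingCoeff_le_one {Ω : Type*} [MeasurableSpace Ω] (Y : ℤ → Ω → ℝ) (μ : Measure Ω)
    [IsProbabilityMeasure μ] (k : ℕ) : mixingCoeff Y μ k ≤ 1 :=
  Real.sSup_le (fun _ hr => one_mem_upperBounds_mixingCoeff Y μ k hr) zero_le_one

theorem abs_measureReal_inter_sub_le_mixingCoeff {Ω : Type*} [MeasurableSpace Ω]
    (Y : ℤ → Ω → ℝ) (μ : Measure Ω) [IsProbabilityMeasure μ] (k : ℕ) {A B : Set Ω}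
    (hA : MeasurableSet[sigmaPast Y 0] A) (hB : MeasurableSet[sigmaFuture Y (k : ℤ)] B) :
    |μ.real (A ∩ B) - μ.real A * μ.real B| ≤ mixingCoeff Y μ k :=
  le_csSup ⟨1, one_mem_upperBounds_mixingCoeff Y μ k⟩ ⟨A, B, hA, hB, rfl⟩

/-- Since the mixing coefficients lie in `[0, 1]`, raising them to the power `β < 1` makes them
larger. -/
theorem summable_mixingCoeff {Ω : Type*} [MeasurableSpace Ω] {Y : ℤ → Ω → ℝ} {μ : Measure Ω}
    [IsProbabilityMeasure μ] {β : ℝ} (hβ : β ∈ Set.Ioo (0 : ℝ) 1)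
    (h : Summable fun j : ℕ => mixingCoeff Y μ (j + 1) ^ β) :
    Summable fun j : ℕ => mixingCoeff Y μ (j + 1) := by
  refine h.of_nonneg_of_le (fun j => mixingCoeff_nonneg Y μ _) fun j => ?_
  exact Real.self_le_rpow_of_le_one (mixingCoeff_nonneg Y μ _) (mixingCoeff_le_one Y μ _) hβ.2.le

/-! ### Averaging over the noise -/

/-- Expectation as an iterated integral: first over `W` with the value of `Y` held fixed. -/
theorem integral_comp_prod_of_indepFun {Ω S T : Type*} [MeasurableSpace Ω] [MeasurableSpace S]
    [MeasurableSpace T] {μ : Measure Ω} [IsProbabilityMeasure μ] {Y : Ω → S} {W : Ω → T}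
    (hY : Measurable Y) (hW : Measurable W) (hYW : IndepFun Y W μ) {F : S → T → ℝ}
    (hF : Measurable (Function.uncurry F)) {b : ℝ} (hb : ∀ s t, |F s t| ≤ b) :
    ∫ ω, F (Y ω) (W ω) ∂μ = ∫ ω, ∫ ω', F (Y ω) (W ω') ∂μ ∂μ := by
  have h := (indepFun_iff_map_prod_eq_prod_map_map hY.aemeasurable hW.aemeasurable).1 hYW
  have : IsProbabilityMeasure (μ.map Y) := Measure.isProbabilityMeasure_map hY.aemeasurable
  have : IsProbabilityMeasure (μ.map W) := Measure.isProbabilityMeasure_map hW.aemeasurable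
  have hi : Integrable (Function.uncurry F) ((μ.map Y).prod (μ.map W)) :=
    Integrable.of_bound hF.aestronglyMeasurable b (ae_of_all _ fun q => hb q.1 q.2)
  calc ∫ ω, F (Y ω) (W ω) ∂μ = ∫ q, Function.uncurry F q ∂(μ.map fun ω => (Y ω, W ω)) :=
        (integral_map (hY.prodMk hW).aemeasurable hF.aestronglyMeasurable).symm
    _ = ∫ s, ∫ t, F s t ∂(μ.map W) ∂(μ.map Y) := by rw [h, integral_prod _ hi]; rfl
    _ = ∫ ω, ∫ t, F (Y ω) t ∂(μ.map W) ∂μ :=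
        integral_map hY.aemeasurable
          (hF.stronglyMeasurable.integral_prod_right.aestronglyMeasurable)
    _ = _ := by
        congr 1
        funext ω
        exact integral_map hW.aemeasurable
          (hF.comp measurable_prodMk_left).aestronglyMeasurable

section ConditionW

variable {w : ℝ → ℝ} {A α : ℝ}

/-- Averaging the deconvolution kernel over the noise `log Z²` undoes the division by `φ_k` and
gives back the kernel `w`. -/
theorem ConditionW.integral_deconvKernelOne (hw : ConditionW w A α) (h a : ℝ) :
    ∫ z, deconvKernelOne w h (h⁻¹ * (a - Real.log (z ^ 2))) ∂(gaussianReal 0 1) =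
      contVersion w (h⁻¹ * a) := by
  have hF := hw.integrable_deconvFt h
  have key : ∫ z, invFt (deconvFt w h) (h⁻¹ * (a - Real.log (z ^ 2))) ∂(gaussianReal 0 1) =
      invFt (ft w) (h⁻¹ * a) := by
    simp only [invFt]
    rw [integral_const_mul]
    congr 1
    rw [integral_integral_swap]
    · congr 1
      funext s
      rw [integral_const_mul]
      have e : ∀ z : ℝ, Complex.exp
          (-(Complex.I * ((s * (h⁻¹ * (a - Real.log (z ^ 2))) : ℝ) : ℂ))) =
          Complex.exp (-(Complex.I * ((s * (h⁻¹ * a) : ℝ) : ℂ))) *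
            Complex.exp (Complex.I * ((h⁻¹ * s * Real.log (z ^ 2) : ℝ) : ℂ)) := by
        intro z
        rw [← Complex.exp_add]
        congr 1
        push_cast
        ring
      simp_rw [e]
      rw [integral_const_mul, integral_gaussian_logSq, deconvFt]
      rw [div_mul_eq_mul_div, div_eq_iff (ft_logSqDensity_ne_zero (h⁻¹ * s))]
      ring
    · refine (hF.comp_snd (gaussianReal 0 1)).mul_bdd (c := 1) ?_ (ae_of_all _ fun q => ?_)
      · refine Measurable.aestronglyMeasurable ?_
        fun_prop
      · rw [← mul_neg, mul_comm, ← Complex.ofReal_neg, Complex.norm_exp_ofReal_mul_I]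
  have : ((∫ z, deconvKernelOne w h (h⁻¹ * (a - Real.log (z ^ 2))) ∂(gaussianReal 0 1) : ℝ) : ℂ) =
      contVersion w (h⁻¹ * a) := by
    rw [← integral_complex_ofReal, ofReal_contVersion, ← key]
    simp_rw [ofReal_deconvKernelOne]
  exact_mod_cast this

end ConditionW

/-- The summand of the estimator belonging to the index `j`, with the logarithm of
`X_t² = σ_t² Z_t²` expanded, as a function of the volatility path `s` and the noise path `z`. -/
noncomputable def splitTerm (p : ℕ) (w : ℝ → ℝ) (h : ℝ) (x : Fin p → ℝ) (j : ℤ)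
    (s z : ℤ → ℝ) : ℝ :=
  ∏ i : Fin p, deconvKernelOne w h
    (h⁻¹ * (x i - Real.log (s (j - (i : ℤ)) ^ 2) - Real.log (z (j - (i : ℤ)) ^ 2)))

/-- The kernel evaluated at the volatilities: the conditional mean given `σ` of the summand of the
estimator belonging to the index `j`. -/
noncomputable def smoothTerm (p : ℕ) (w : ℝ → ℝ) (h : ℝ) (x : Fin p → ℝ) (j : ℤ)
    (s : ℤ → ℝ) : ℝ :=
  ∏ i : Fin p, contVersion w (h⁻¹ * (x i - Real.log (s (j - (i : ℤ)) ^ 2)))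

section Terms

variable {p : ℕ} {w : ℝ → ℝ} {A α : ℝ}

theorem ConditionW.measurable_splitTerm (hw : ConditionW w A α) (h : ℝ) (x : Fin p → ℝ) (j : ℤ) :
    Measurable (Function.uncurry (splitTerm p w h x j)) := by
  have := (hw.continuous_deconvKernelOne h).measurable
  unfold splitTerm Function.uncurry
  fun_prop

theorem ConditionW.measurable_smoothTerm (hw : ConditionW w A α) (h : ℝ) (x : Fin p → ℝ) (j : ℤ) :
    Measurable (smoothTerm p w h x j) := by
  have := hw.continuous_contVersion.measurable
  unfold smoothTerm
  fun_prop

theorem abs_prod_le_pow {p : ℕ} {y : Fin p → ℝ} {b : ℝ} (hb : ∀ i, |y i| ≤ b) :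
    |∏ i, y i| ≤ b ^ p := by
  rw [Finset.abs_prod]
  refine (Finset.prod_le_prod (fun _ _ => abs_nonneg _) fun i _ => hb i).trans (le_of_eq ?_)
  simp

theorem exists_abs_splitTerm_le (p : ℕ) (w : ℝ → ℝ) (h : ℝ) :
    ∃ b, ∀ x j s z, |splitTerm p w h x j s z| ≤ b := by
  obtain ⟨b, hb⟩ := exists_abs_deconvKernelOne_le w h
  exact ⟨b ^ p, fun x j s z => abs_prod_le_pow fun i => hb _⟩

theorem exists_abs_smoothTerm_le (p : ℕ) (w : ℝ → ℝ) :
    ∃ b, 0 ≤ b ∧ ∀ h x j s, |smoothTerm p w h x j s| ≤ b := by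
  obtain ⟨b, hb⟩ := exists_abs_contVersion_le w
  have hb0 : 0 ≤ b := (abs_nonneg _).trans (hb 0)
  exact ⟨b ^ p, by positivity, fun h x j s => abs_prod_le_pow fun i => hb _⟩

variable {Ω : Type*} [MeasurableSpace Ω] {μ : Measure Ω} {Z : ℤ → Ω → ℝ}

theorem ConditionW.integral_prod_deconvKernelOne (hw : ConditionW w A α)
    (hZ_meas : ∀ t, Measurable (Z t)) (hZ_indep : iIndepFun Z μ)
    (hZ_gauss : ∀ t, μ.map (Z t) = gaussianReal 0 1) (h : ℝ) {ι : Type*} [Fintype ι] (τ : ι → ℤ)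
    (hτ : Function.Injective τ) (a : ι → ℝ) :
    ∫ ω, ∏ i, deconvKernelOne w h (h⁻¹ * (a i - Real.log (Z (τ i) ω ^ 2))) ∂μ =
      ∏ i, contVersion w (h⁻¹ * a i) := by
  have hm : ∀ c : ℝ,
      Measurable fun z : ℝ => deconvKernelOne w h (h⁻¹ * (c - Real.log (z ^ 2))) := by
    have := (hw.continuous_deconvKernelOne h).measurable
    fun_prop
  have := (hZ_indep.precomp hτ).integral_fun_prod_comp
    (f := fun i z => deconvKernelOne w h (h⁻¹ * (a i - Real.log (z ^ 2))))
    (fun i => (hZ_meas _).aemeasurable) (fun i => (hm (a i)).aestronglyMeasurable)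
  rw [this]
  refine Finset.prod_congr rfl fun i _ => ?_
  rw [← hw.integral_deconvKernelOne h (a i), ← hZ_gauss (τ i),
    integral_map (hZ_meas _).aemeasurable (hm (a i)).aestronglyMeasurable]

theorem ConditionW.integral_splitTerm (hw : ConditionW w A α)
    (hZ_meas : ∀ t, Measurable (Z t)) (hZ_indep : iIndepFun Z μ)
    (hZ_gauss : ∀ t, μ.map (Z t) = gaussianReal 0 1) (h : ℝ) (x : Fin p → ℝ) (j : ℤ)
    (s : ℤ → ℝ) :
    ∫ ω, splitTerm p w h x j s (fun t => Z t ω) ∂μ = smoothTerm p w h x j s :=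
  hw.integral_prod_deconvKernelOne hZ_meas hZ_indep hZ_gauss h (fun i : Fin p => j - (i : ℤ))
    (fun a b hab => by simpa [Fin.ext_iff] using hab) _

/-- Two summands whose index sets do not overlap use disjoint sets of noise variables, and so are
independent conditionally on `σ`. -/
theorem ConditionW.integral_splitTerm_mul (hw : ConditionW w A α)
    (hZ_meas : ∀ t, Measurable (Z t)) (hZ_indep : iIndepFun Z μ)
    (hZ_gauss : ∀ t, μ.map (Z t) = gaussianReal 0 1) (h : ℝ) (x : Fin p → ℝ) {j k : ℤ}
    (hjk : j + p ≤ k) (s : ℤ → ℝ) :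
    ∫ ω, splitTerm p w h x j s (fun t => Z t ω) * splitTerm p w h x k s (fun t => Z t ω) ∂μ =
      smoothTerm p w h x j s * smoothTerm p w h x k s := by
  -- the time indices of the two blocks together form a family without repetitions
  have hτ : Function.Injective
      (Sum.elim (fun i : Fin p => j - (i : ℤ)) fun i : Fin p => k - (i : ℤ)) := by
    rintro (a | a) (b | b) hab <;> simp only [Sum.elim_inl, Sum.elim_inr] at hab
    · congr 1; ext; omega
    · have := b.2; omega
    · have := a.2; omega
    · congr 1; ext; omega
  have := hw.integral_prod_deconvKernelOne hZ_meas hZ_indep hZ_gauss h _ hτ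
    (Sum.elim (fun i : Fin p => x i - Real.log (s (j - (i : ℤ)) ^ 2))
      fun i : Fin p => x i - Real.log (s (k - (i : ℤ)) ^ 2))
  simp only [Fintype.prod_sum_type, Sum.elim_inl, Sum.elim_inr] at this
  exact this

end Terms

/-! ### Stationarity and moments of the summands -/

section Stationary

variable {Ω : Type*} [MeasurableSpace Ω] {μ : Measure Ω} {σ : ℤ → Ω → ℝ}

theorem StrictlyStationary.covariance_comp_shift (hσ : StrictlyStationary σ μ)
    (hσ_meas : ∀ t, Measurable (σ t)) {G H : (ℤ → ℝ) → ℝ} (hG : Measurable G) (hH : Measurable H)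
    (m : ℤ) :
    cov[fun ω => G (fun t => σ (t + m) ω), fun ω => H (fun t => σ (t + m) ω); μ] =
      cov[fun ω => G (fun t => σ t ω), fun ω => H (fun t => σ t ω); μ] := by
  have h1 : Measurable fun ω t => σ (t + m) ω := measurable_pi_lambda _ fun t => hσ_meas _
  have h2 : Measurable fun ω t => σ t ω := measurable_pi_lambda _ fun t => hσ_meas _
  rw [← covariance_map_fun hG.aestronglyMeasurable hH.aestronglyMeasurable h1.aemeasurable, hσ m,
    covariance_map_fun hG.aestronglyMeasurable hH.aestronglyMeasurable h2.aemeasurable]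

theorem StrictlyStationary.map_logSqVec (hσ : StrictlyStationary σ μ)
    (hσ_meas : ∀ t, Measurable (σ t)) (p : ℕ) (j k : ℤ) :
    μ.map (logSqVec p σ j) = μ.map (logSqVec p σ k) := by
  have h1 : Measurable fun ω t => σ (t + (j - k)) ω := measurable_pi_lambda _ fun t => hσ_meas _
  have h2 : Measurable fun ω t => σ t ω := measurable_pi_lambda _ fun t => hσ_meas _
  have hΦ : Measurable fun (s : ℤ → ℝ) (i : Fin p) => Real.log (s (k - (i : ℤ)) ^ 2) := by
    fun_prop
  have e : logSqVec p σ j = (fun (s : ℤ → ℝ) (i : Fin p) => Real.log (s (k - (i : ℤ)) ^ 2)) ∘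
      fun ω t => σ (t + (j - k)) ω := by
    funext ω i
    simp only [logSqVec, Function.comp_apply]
    congr 4
    ring
  rw [e, ← Measure.map_map hΦ h1, hσ (j - k), Measure.map_map hΦ h2]
  rfl

end Stationary

section Terms

variable {p : ℕ} {w : ℝ → ℝ} {A α : ℝ} {f : (Fin p → ℝ) → ℝ}
  {Ω : Type*} [MeasurableSpace Ω] {μ : Measure Ω} {σ Z X : ℤ → Ω → ℝ}

theorem measurable_logSqVec (hσ_meas : ∀ t, Measurable (σ t)) (j : ℤ) :
    Measurable (logSqVec p σ j) := by
  unfold logSqVec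
  have := hσ_meas
  fun_prop

theorem integral_logSqVec (hσ_stat : StrictlyStationary σ μ) (hσ_meas : ∀ t, Measurable (σ t))
    (hf_nonneg : ∀ x, 0 ≤ f x) (hf : Measurable f)
    (hf_density : μ.map (logSqVec p σ (p : ℤ)) = volume.withDensity fun x => ENNReal.ofReal (f x))
    (j : ℤ) {G : (Fin p → ℝ) → ℝ} (hG : Measurable G) :
    ∫ ω, G (logSqVec p σ j ω) ∂μ = ∫ l, f l * G l := by
  rw [← integral_map (measurable_logSqVec hσ_meas j).aemeasurable hG.aestronglyMeasurable,
    hσ_stat.map_logSqVec hσ_meas p j p, hf_density,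
    integral_withDensity_eq_integral_toReal_smul (by fun_prop) (by simp)]
  simp_rw [ENNReal.toReal_ofReal (hf_nonneg _), smul_eq_mul]

/-- The identity `log X_t² = log σ_t² + log Z_t²` needs `σ_t` and `Z_t` to be nonzero, so it holds
almost surely only. -/
theorem deconvKernel_ae_eq_splitTerm (hX : ∀ t ω, X t ω = σ t ω * Z t ω)
    (hσ_pos : ∀ t, ∀ᵐ ω ∂μ, 0 < σ t ω) (hZ_meas : ∀ t, Measurable (Z t))
    (hZ_gauss : ∀ t, μ.map (Z t) = gaussianReal 0 1) (w : ℝ → ℝ) (h : ℝ) (x : Fin p → ℝ) (j : ℤ) :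
    (fun ω => deconvKernel p w h (h⁻¹ • (x - logSqVec p X j ω))) =ᵐ[μ]
      fun ω => splitTerm p w h x j (fun t => σ t ω) fun t => Z t ω := by
  have hZ0 : ∀ t, ∀ᵐ ω ∂μ, Z t ω ≠ 0 := by
    intro t
    have : NullSingletonClass (gaussianReal 0 1) := nullSingletonClass_gaussianReal one_ne_zero
    have h0 : ∀ᵐ z ∂(μ.map (Z t)), z ≠ 0 := by
      rw [hZ_gauss t]
      exact compl_mem_ae_iff.2 (measure_singleton 0)
    exact ae_of_ae_map (hZ_meas t).aemeasurable h0
  filter_upwards [ae_all_iff.2 hσ_pos, ae_all_iff.2 hZ0] with ω h1 h2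
  rw [deconvKernel_eq_prod, splitTerm]
  refine Finset.prod_congr rfl fun i _ => ?_
  simp only [Pi.smul_apply, Pi.sub_apply, smul_eq_mul, logSqVec, hX]
  rw [mul_pow, Real.log_mul (pow_ne_zero 2 (h1 _).ne') (pow_ne_zero 2 (h2 _)), sub_sub]

/-- With the noise path `z` held fixed, the second moment is an integral of the squared kernel
against the density `f ≤ M`; the shift by `log z²` does not matter by translation invariance, so no density
of the observations is needed. -/
theorem ConditionW.integral_sq_splitTerm_le (hw : ConditionW w A α)
    (hσ_meas : ∀ t, Measurable (σ t)) (hσ_stat : StrictlyStationary σ μ)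
    (hf_nonneg : ∀ x, 0 ≤ f x) (hf : Measurable f)
    (hf_density : μ.map (logSqVec p σ (p : ℤ)) = volume.withDensity fun x => ENNReal.ofReal (f x))
    {M : ℝ} (hM : ∀ x, f x ≤ M) {h : ℝ} (hh : 0 < h) (x : Fin p → ℝ) (j : ℤ) (z : ℤ → ℝ) :
    ∫ ω, splitTerm p w h x j (fun t => σ t ω) z ^ 2 ∂μ ≤
      M * (h * ∫ y, deconvKernelOne w h y ^ 2) ^ p := by
  set g : Fin p → ℝ → ℝ := fun i l => deconvKernelOne w h
    (h⁻¹ * (x i - l - Real.log (z (j - (i : ℤ)) ^ 2))) ^ 2 with hg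
  have hgm : ∀ i, Measurable (g i) := fun i => by
    have := (hw.continuous_deconvKernelOne h).measurable
    fun_prop
  have hsq := hw.integrable_sq_deconvKernelOne h
  have hcomp : ∀ i, g i = fun l => (fun y => deconvKernelOne w h (h⁻¹ * y) ^ 2)
      (x i - Real.log (z (j - (i : ℤ)) ^ 2) - l) := fun i => by
    funext l
    simp only [hg]
    ring_nf
  have hgi : ∀ i, Integrable (g i) := fun i => by
    rw [hcomp i]
    exact (hsq.comp_mul_left' (inv_ne_zero hh.ne')).comp_sub_left _
  have hgv : ∀ i, ∫ l, g i l = h * ∫ y, deconvKernelOne w h y ^ 2 := fun i => by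
    rw [hcomp i, integral_sub_left_eq_self (fun y => deconvKernelOne w h (h⁻¹ * y) ^ 2),
      Measure.integral_comp_mul_left (fun y => deconvKernelOne w h y ^ 2), inv_inv,
      abs_of_pos hh, smul_eq_mul]
  have e : ∀ ω, splitTerm p w h x j (fun t => σ t ω) z ^ 2 =
      (fun l : Fin p → ℝ => ∏ i, g i (l i)) (logSqVec p σ j ω) := fun ω => by
    rw [splitTerm, ← Finset.prod_pow]
    rfl
  simp_rw [e]
  have hG : Integrable fun l : Fin p → ℝ => ∏ i, g i (l i) := Integrable.fintype_prod hgi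
  have hG0 : ∀ l : Fin p → ℝ, 0 ≤ ∏ i, g i (l i) :=
    fun l => Finset.prod_nonneg fun i _ => sq_nonneg _
  rw [integral_logSqVec hσ_stat hσ_meas hf_nonneg hf hf_density j
    (G := fun l => ∏ i, g i (l i)) (by fun_prop)]
  calc ∫ l, f l * ∏ i, g i (l i) ≤ ∫ l : Fin p → ℝ, M * ∏ i, g i (l i) :=
        integral_mono_of_nonneg (ae_of_all _ fun l => mul_nonneg (hf_nonneg l) (hG0 l))
          (hG.const_mul M) (ae_of_all _ fun l => mul_le_mul_of_nonneg_right (hM l) (hG0 l))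
    _ = _ := by
        rw [integral_const_mul, integral_fintype_prod_volume_eq_prod]
        simp_rw [hgv]
        simp

variable [IsProbabilityMeasure μ]

theorem ConditionW.integral_deconvKernel (hw : ConditionW w A α)
    (hX : ∀ t ω, X t ω = σ t ω * Z t ω) (hσ_meas : ∀ t, Measurable (σ t))
    (hZ_meas : ∀ t, Measurable (Z t)) (hσ_pos : ∀ t, ∀ᵐ ω ∂μ, 0 < σ t ω)
    (hZ_indep : iIndepFun Z μ) (hZ_gauss : ∀ t, μ.map (Z t) = gaussianReal 0 1)
    (hσZ : IndepFun (fun ω t => σ t ω) (fun ω t => Z t ω) μ) (h : ℝ) (x : Fin p → ℝ) (j : ℤ) :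
    ∫ ω, deconvKernel p w h (h⁻¹ • (x - logSqVec p X j ω)) ∂μ =
      ∫ ω, smoothTerm p w h x j (fun t => σ t ω) ∂μ := by
  obtain ⟨b, hb⟩ := exists_abs_splitTerm_le p w h
  rw [integral_congr_ae (deconvKernel_ae_eq_splitTerm hX hσ_pos hZ_meas hZ_gauss w h x j),
    integral_comp_prod_of_indepFun (measurable_pi_lambda _ hσ_meas)
      (measurable_pi_lambda _ hZ_meas) hσZ (hw.measurable_splitTerm h x j) (hb x j)]
  simp_rw [hw.integral_splitTerm hZ_meas hZ_indep hZ_gauss]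

/-- At lag at least `p`, the noise drops out of the covariances. -/
theorem ConditionW.covariance_deconvKernel (hw : ConditionW w A α)
    (hX : ∀ t ω, X t ω = σ t ω * Z t ω) (hσ_meas : ∀ t, Measurable (σ t))
    (hZ_meas : ∀ t, Measurable (Z t)) (hσ_pos : ∀ t, ∀ᵐ ω ∂μ, 0 < σ t ω)
    (hZ_indep : iIndepFun Z μ) (hZ_gauss : ∀ t, μ.map (Z t) = gaussianReal 0 1)
    (hσZ : IndepFun (fun ω t => σ t ω) (fun ω t => Z t ω) μ) (h : ℝ) (x : Fin p → ℝ) {j k : ℤ}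
    (hjk : j + p ≤ k) :
    cov[fun ω => deconvKernel p w h (h⁻¹ • (x - logSqVec p X j ω)),
      fun ω => deconvKernel p w h (h⁻¹ • (x - logSqVec p X k ω)); μ] =
      cov[fun ω => smoothTerm p w h x j (fun t => σ t ω),
        fun ω => smoothTerm p w h x k (fun t => σ t ω); μ] := by
  obtain ⟨b, hb⟩ := exists_abs_splitTerm_le p w h
  obtain ⟨c, hc0, hc⟩ := exists_abs_smoothTerm_le p w
  have hσm : Measurable fun ω t => σ t ω := measurable_pi_lambda _ hσ_meas
  have hZm : Measurable fun ω t => Z t ω := measurable_pi_lambda _ hZ_meas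
  have hb0 : 0 ≤ b := (abs_nonneg _).trans (hb 0 0 0 0)
  have e := deconvKernel_ae_eq_splitTerm hX hσ_pos hZ_meas hZ_gauss w h x
  have hm : ∀ i, MemLp (fun ω => splitTerm p w h x i (fun t => σ t ω) fun t => Z t ω) 2 μ :=
    fun i => MemLp.of_bound ((hw.measurable_splitTerm h x i).comp
      (hσm.prodMk hZm)).aestronglyMeasurable b (ae_of_all _ fun ω => hb _ _ _ _)
  have hs : ∀ i, MemLp (fun ω => smoothTerm p w h x i (fun t => σ t ω)) 2 μ :=
    fun i => MemLp.of_bound ((hw.measurable_smoothTerm h x i).comp hσm).aestronglyMeasurable c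
      (ae_of_all _ fun ω => hc _ _ _ _)
  have hmul : ∀ s z, |splitTerm p w h x j s z * splitTerm p w h x k s z| ≤ b * b := by
    intro s z
    rw [abs_mul]
    exact mul_le_mul (hb _ _ _ _) (hb _ _ _ _) (abs_nonneg _) hb0
  rw [covariance_eq_sub ((memLp_congr_ae (e j)).2 (hm j)) ((memLp_congr_ae (e k)).2 (hm k)),
    covariance_eq_sub (hs j) (hs k),
    hw.integral_deconvKernel hX hσ_meas hZ_meas hσ_pos hZ_indep hZ_gauss hσZ h x j,
    hw.integral_deconvKernel hX hσ_meas hZ_meas hσ_pos hZ_indep hZ_gauss hσZ h x k]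
  congr 1
  rw [integral_congr_ae ((e j).mul (e k))]
  have := integral_comp_prod_of_indepFun hσm hZm hσZ
    (F := fun s z => splitTerm p w h x j s z * splitTerm p w h x k s z)
    ((hw.measurable_splitTerm h x j).mul (hw.measurable_splitTerm h x k)) hmul
  refine this.trans ?_
  simp_rw [hw.integral_splitTerm_mul hZ_meas hZ_indep hZ_gauss h x hjk]
  rfl

/-- The mixing condition bounds the covariance of the smoothed terms: `smoothTerm … j` depends on
`σ_{j-p+1}, …, σ_j`, which leaves a gap of `k - j - p + 1` between the two blocks. -/
theorem ConditionW.abs_covariance_smoothTerm_le (hw : ConditionW w A α)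
    (hσ_meas : ∀ t, Measurable (σ t)) (hσ_stat : StrictlyStationary σ μ) (h : ℝ) (x : Fin p → ℝ)
    {b : ℝ} (hb : ∀ j s, |smoothTerm p w h x j s| ≤ b) (j : ℤ) (m : ℕ) :
    |cov[fun ω => smoothTerm p w h x j (fun t => σ t ω),
        fun ω => smoothTerm p w h x (j + m + p) (fun t => σ t ω); μ]| ≤
      4 * b * b * mixingCoeff σ μ (m + 1) := by
  have e : ∀ i ω, smoothTerm p w h x (j + i) (fun t => σ t ω) =
      smoothTerm p w h x i (fun t => σ (t + j) ω) := by
    intro i ω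
    unfold smoothTerm
    refine Finset.prod_congr rfl fun a _ => ?_
    congr 6
    ring
  have e0 := e 0
  have e1 := e (m + p)
  rw [add_zero] at e0
  rw [← add_assoc] at e1
  simp_rw [e0, e1]
  rw [hσ_stat.covariance_comp_shift hσ_meas (hw.measurable_smoothTerm h x 0)
    (hw.measurable_smoothTerm h x (m + p))]
  have hcv := hw.continuous_contVersion.measurable
  refine abs_covariance_le (m₁ := sigmaPast σ 0) (m₂ := sigmaFuture σ ((m + 1 : ℕ) : ℤ))
    (iSup₂_le fun t _ => (hσ_meas t).comap_le) (iSup₂_le fun t _ => (hσ_meas t).comap_le)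
    ?_ (fun ω => hb _ _) ?_ (fun ω => hb _ _)
    fun B C hB hC => abs_measureReal_inter_sub_le_mixingCoeff σ μ (m + 1) hB hC
  · have hmeas : ∀ t ≤ 0, Measurable[sigmaPast σ 0] (σ t) := fun t ht =>
      (comap_measurable (σ t)).mono (le_iSup₂_of_le t ht le_rfl) le_rfl
    refine Finset.measurable_fun_prod _ fun i _ => ?_
    have := hmeas (0 - (i : ℤ)) (by omega)
    fun_prop
  · have hmeas : ∀ t, ((m + 1 : ℕ) : ℤ) ≤ t →
        Measurable[sigmaFuture σ ((m + 1 : ℕ) : ℤ)] (σ t) := fun t ht =>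
      (comap_measurable (σ t)).mono (le_iSup₂_of_le t ht le_rfl) le_rfl
    refine Finset.measurable_fun_prod _ fun i _ => ?_
    have := hmeas (m + p - (i : ℤ)) (by have := i.2; push_cast; omega)
    fun_prop

theorem ConditionW.integral_sq_deconvKernel_le (hw : ConditionW w A α)
    (hX : ∀ t ω, X t ω = σ t ω * Z t ω) (hσ_meas : ∀ t, Measurable (σ t))
    (hZ_meas : ∀ t, Measurable (Z t)) (hσ_pos : ∀ t, ∀ᵐ ω ∂μ, 0 < σ t ω)
    (hσ_stat : StrictlyStationary σ μ) (hZ_gauss : ∀ t, μ.map (Z t) = gaussianReal 0 1)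
    (hσZ : IndepFun (fun ω t => σ t ω) (fun ω t => Z t ω) μ)
    (hf_nonneg : ∀ x, 0 ≤ f x) (hf : Measurable f)
    (hf_density : μ.map (logSqVec p σ (p : ℤ)) = volume.withDensity fun x => ENNReal.ofReal (f x))
    {M : ℝ} (hM : ∀ x, f x ≤ M) {h : ℝ} (hh : 0 < h) (x : Fin p → ℝ) (j : ℤ) :
    ∫ ω, deconvKernel p w h (h⁻¹ • (x - logSqVec p X j ω)) ^ 2 ∂μ ≤
      M * (h * ∫ y, deconvKernelOne w h y ^ 2) ^ p := by
  obtain ⟨b, hb⟩ := exists_abs_splitTerm_le p w h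
  have hσm : Measurable fun ω t => σ t ω := measurable_pi_lambda _ hσ_meas
  have hZm : Measurable fun ω t => Z t ω := measurable_pi_lambda _ hZ_meas
  have e := deconvKernel_ae_eq_splitTerm hX hσ_pos hZ_meas hZ_gauss w h x j
  have e2 : ∫ ω, deconvKernel p w h (h⁻¹ • (x - logSqVec p X j ω)) ^ 2 ∂μ =
      ∫ ω, splitTerm p w h x j (fun t => σ t ω) (fun t => Z t ω) ^ 2 ∂μ :=
    integral_congr_ae (e.pow_const 2)
  rw [e2]
  have := integral_comp_prod_of_indepFun hZm hσm hσZ.symm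
    (F := fun z s => splitTerm p w h x j s z ^ 2)
    (((hw.measurable_splitTerm h x j).comp measurable_swap).pow_const 2) (b := b ^ 2)
    fun z s => by
      rw [abs_pow]
      exact pow_le_pow_left₀ (abs_nonneg _) (hb _ _ _ _) 2
  refine this.trans_le ?_
  have hle := fun z => hw.integral_sq_splitTerm_le hσ_meas hσ_stat hf_nonneg hf hf_density hM hh x
    j z
  refine (integral_mono_of_nonneg (ae_of_all _ fun ω => integral_nonneg fun _ => sq_nonneg _)
    (integrable_const _) (ae_of_all _ fun ω => hle _)).trans (le_of_eq ?_)
  simp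

end Terms

/-! ### The variance of the estimator -/

/-- If the covariances at lag `m` are at most `r m`, each row of the covariance matrix of the
summands sums to at most `2 ∑ r m`. -/
theorem variance_sum_le_of_abs_covariance_le {Ω : Type*} [MeasurableSpace Ω] {μ : Measure Ω}
    [IsProbabilityMeasure μ] {V : ℕ → Ω → ℝ} (hV : ∀ j, MemLp (V j) 2 μ) {r : ℕ → ℝ}
    (hr : Summable r) (hcov : ∀ j m, |cov[V j, V (j + m); μ]| ≤ r m) (s : Finset ℕ) :
    Var[fun ω => ∑ j ∈ s, V j ω; μ] ≤ s.card * (2 * ∑' m, r m) := by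
  have hr0 : ∀ m, 0 ≤ r m := fun m => (abs_nonneg _).trans (hcov 0 m)
  have hsub : ∀ (t : Finset ℕ) (d : ℕ → ℕ), Set.InjOn d t → ∑ j ∈ t, r (d j) ≤ ∑' m, r m := by
    intro t d hd
    rw [← Finset.sum_image hd]
    exact hr.sum_le_tsum _ fun m _ => hr0 m
  have hrow : ∀ i, ∑ j ∈ s, cov[V i, V j; μ] ≤ 2 * ∑' m, r m := by
    intro i
    rw [← Finset.sum_filter_add_sum_filter_not s (fun j => i ≤ j), two_mul]
    refine add_le_add ?_ ?_
    · refine le_trans (Finset.sum_le_sum fun j hj => ?_) (hsub _ (fun j => j - i) ?_)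
      · obtain ⟨m, rfl⟩ := Nat.exists_eq_add_of_le (Finset.mem_filter.1 hj).2
        simpa using (le_abs_self _).trans (hcov i m)
      · intro a ha b hb hab
        simp only [Finset.coe_filter, Set.mem_ofPred_eq] at ha hb hab
        omega
    · refine le_trans (Finset.sum_le_sum fun j hj => ?_) (hsub _ (fun j => i - j) ?_)
      · obtain ⟨m, rfl⟩ := Nat.exists_eq_add_of_le (le_of_not_ge (Finset.mem_filter.1 hj).2)
        rw [covariance_comm]
        simpa using (le_abs_self _).trans (hcov j m)
      · intro a ha b hb hab
        simp only [Finset.coe_filter, Set.mem_ofPred_eq] at ha hb hab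
        omega
  rw [variance_fun_sum' fun i _ => hV i]
  refine (Finset.sum_le_sum fun i _ => hrow i).trans (le_of_eq ?_)
  simp

theorem abs_covariance_le_of_integral_sq_le {Ω : Type*} [MeasurableSpace Ω] {μ : Measure Ω}
    [IsProbabilityMeasure μ] {U V : Ω → ℝ} (hU : MemLp U 2 μ) (hV : MemLp V 2 μ) {D : ℝ}
    (hUD : ∫ ω, U ω ^ 2 ∂μ ≤ D) (hVD : ∫ ω, V ω ^ 2 ∂μ ≤ D) : |cov[U, V; μ]| ≤ D := by
  have h1 := variance_nonneg (U + V) μ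
  have h2 := variance_nonneg (U - V) μ
  rw [variance_add hU hV] at h1
  rw [variance_sub hU hV] at h2
  have h3 := (variance_le_expectation_sq hU.1).trans hUD
  have h4 := (variance_le_expectation_sq hV.1).trans hVD
  rw [abs_le]
  constructor <;> linarith

section Estimator

variable {p : ℕ} {w : ℝ → ℝ} {A α : ℝ} {f : (Fin p → ℝ) → ℝ}
  {Ω : Type*} [MeasurableSpace Ω] {μ : Measure Ω} [IsProbabilityMeasure μ] {σ Z X : ℤ → Ω → ℝ}

theorem ConditionW.memLp_deconvKernel (hw : ConditionW w A α) (hX_meas : ∀ t, Measurable (X t))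
    (h : ℝ) (x : Fin p → ℝ) (j : ℤ) :
    MemLp (fun ω => deconvKernel p w h (h⁻¹ • (x - logSqVec p X j ω))) 2 μ := by
  obtain ⟨b, hb⟩ := exists_abs_deconvKernelOne_le w h
  have := (hw.continuous_deconvKernelOne h).measurable
  have := measurable_logSqVec (p := p) hX_meas j
  simp_rw [deconvKernel_eq_prod]
  refine MemLp.of_bound (Measurable.aestronglyMeasurable ?_) (b ^ p)
    (ae_of_all _ fun ω => abs_prod_le_pow fun i => hb _)
  fun_prop

theorem ConditionW.memLp_estimator (hw : ConditionW w A α) (hX_meas : ∀ t, Measurable (X t))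
    (n : ℕ) (h : ℝ) (x : Fin p → ℝ) : MemLp (estimator p w X n h x) 2 μ := by
  unfold estimator
  exact (memLp_finsetSum _ fun (j : ℕ) _ =>
    hw.memLp_deconvKernel (μ := μ) hX_meas h x (j : ℤ)).const_mul _

theorem ConditionW.variance_sum_deconvKernel_le (hw : ConditionW w A α)
    (hX : ∀ t ω, X t ω = σ t ω * Z t ω) (hσ_meas : ∀ t, Measurable (σ t))
    (hZ_meas : ∀ t, Measurable (Z t)) (hσ_pos : ∀ t, ∀ᵐ ω ∂μ, 0 < σ t ω)
    (hσ_stat : StrictlyStationary σ μ)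
    (hZ_indep : iIndepFun Z μ) (hZ_gauss : ∀ t, μ.map (Z t) = gaussianReal 0 1)
    (hσZ : IndepFun (fun ω t => σ t ω) (fun ω t => Z t ω) μ)
    (hsum : Summable fun j : ℕ => mixingCoeff σ μ (j + 1))
    (hf_nonneg : ∀ x, 0 ≤ f x) (hf : Measurable f)
    (hf_density : μ.map (logSqVec p σ (p : ℤ)) = volume.withDensity fun x => ENNReal.ofReal (f x))
    {M : ℝ} (hM : ∀ x, f x ≤ M) {h : ℝ} (hh : 0 < h) (x : Fin p → ℝ)
    {b : ℝ} (hb : ∀ j s, |smoothTerm p w h x j s| ≤ b) (s : Finset ℕ) :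
    Var[fun ω => ∑ j ∈ s, deconvKernel p w h (h⁻¹ • (x - logSqVec p X (j : ℤ) ω)); μ] ≤
      s.card * (2 * (p * (M * (h * ∫ y, deconvKernelOne w h y ^ 2) ^ p) +
        4 * b * b * ∑' j : ℕ, mixingCoeff σ μ (j + 1))) := by
  have hX_meas : ∀ t, Measurable (X t) := fun t => by
    rw [funext (hX t)]
    exact (hσ_meas t).mul (hZ_meas t)
  set D := M * (h * ∫ y, deconvKernelOne w h y ^ 2) ^ p with hD
  -- the covariance at lag `m`: Cauchy-Schwarz for overlapping blocks, mixing for disjoint ones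
  set r : ℕ → ℝ := fun m => if m < p then D else 4 * b * b * mixingCoeff σ μ (m - p + 1) with hr
  have hr1 : ∀ m, r (m + p) = 4 * b * b * mixingCoeff σ μ (m + 1) := fun m => by simp [hr]
  have hrs : Summable r := by
    rw [← summable_nat_add_iff p]
    simp_rw [hr1]
    exact hsum.mul_left _
  have hrt : ∑' m, r m = p * D + 4 * b * b * ∑' j : ℕ, mixingCoeff σ μ (j + 1) := by
    rw [← hrs.sum_add_tsum_nat_add p]
    simp_rw [hr1]
    rw [tsum_mul_left, Finset.sum_congr rfl fun m hm => if_pos (Finset.mem_range.1 hm)]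
    simp
  have hL := fun j : ℕ => hw.memLp_deconvKernel (μ := μ) hX_meas h x (j : ℤ)
  have hI := fun j : ℕ => hw.integral_sq_deconvKernel_le hX hσ_meas hZ_meas hσ_pos hσ_stat hZ_gauss
    hσZ hf_nonneg hf hf_density hM hh x (j : ℤ)
  rw [← hrt]
  refine variance_sum_le_of_abs_covariance_le hL hrs (fun j m => ?_) s
  rcases lt_or_ge m p with hm | hm
  · rw [show r m = D from if_pos hm]
    exact abs_covariance_le_of_integral_sq_le (hL j) (hL (j + m)) (hI j) (hI (j + m))
  · obtain ⟨l, rfl⟩ := Nat.exists_eq_add_of_le' hm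
    rw [hr1, hw.covariance_deconvKernel hX hσ_meas hZ_meas hσ_pos hZ_indep hZ_gauss hσZ h x
      (j := (j : ℤ)) (by push_cast; omega)]
    have := hw.abs_covariance_smoothTerm_le hσ_meas hσ_stat h x hb (j : ℤ) l
    rwa [show ((j + (l + p) : ℕ) : ℤ) = (j : ℤ) + l + p by push_cast; ring]

/-- The exponential growth of `e^{π/h}` beats every power of `h`; in particular the contribution of
the mixing term to the variance is negligible. -/
theorem eventually_inv_sq_le (α : ℝ) :
    ∀ᶠ h : ℝ in 𝓝[>] 0, (h ^ 2)⁻¹ ≤ h ^ (2 * α) * Real.exp (Real.pi / h) := by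
  have h1 := (tendsto_exp_mul_div_rpow_atTop (2 * α + 2) Real.pi Real.pi_pos).comp
    tendsto_inv_nhdsGT_zero
  filter_upwards [h1.eventually_ge_atTop 1, self_mem_nhdsWithin] with h hh (hpos : 0 < h)
  simp only [Function.comp_apply] at hh
  rw [Real.inv_rpow hpos.le, div_inv_eq_mul, Real.rpow_add hpos, ← div_eq_mul_inv] at hh
  rw [inv_le_iff_one_le_mul₀ (by positivity)]
  refine hh.trans (le_of_eq ?_)
  norm_cast
  ring

theorem ConditionW.variance_estimator_isBigO (hw : ConditionW w A α) (hp : 1 ≤ p)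
    (hX : ∀ t ω, X t ω = σ t ω * Z t ω) (hσ_meas : ∀ t, Measurable (σ t))
    (hZ_meas : ∀ t, Measurable (Z t)) (hσ_pos : ∀ t, ∀ᵐ ω ∂μ, 0 < σ t ω)
    (hσ_stat : StrictlyStationary σ μ)
    (hZ_indep : iIndepFun Z μ) (hZ_gauss : ∀ t, μ.map (Z t) = gaussianReal 0 1)
    (hσZ : IndepFun (fun ω t => σ t ω) (fun ω t => Z t ω) μ)
    (hsum : Summable fun j : ℕ => mixingCoeff σ μ (j + 1))
    (hf_nonneg : ∀ x, 0 ≤ f x) (hf : Measurable f)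
    (hf_density : μ.map (logSqVec p σ (p : ℤ)) = volume.withDensity fun x => ENNReal.ofReal (f x))
    {M : ℝ} (hM : ∀ x, f x ≤ M) (x : Fin p → ℝ) :
    (fun q : ℕ × ℝ => variance (estimator p w X q.1 q.2 x) μ)
      =O[𝓟 (Set.Ici p) ×ˢ 𝓝[>] 0]
        fun q : ℕ × ℝ => 1 / (q.1 : ℝ) * (q.2 ^ (2 * α) * Real.exp (Real.pi / q.2)) ^ p := by
  obtain ⟨C, hC, hCb⟩ := hw.exists_integral_sq_deconvKernelOne_le
  obtain ⟨b, hb0, hb⟩ := exists_abs_smoothTerm_le p w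
  have hM0 : 0 ≤ M := (hf_nonneg x).trans (hM x)
  set S := ∑' j : ℕ, mixingCoeff σ μ (j + 1) with hS
  have hS0 : 0 ≤ S := tsum_nonneg fun j => mixingCoeff_nonneg _ _ _
  refine IsBigO.of_bound (p * (2 * (p * (M * C ^ p) + 4 * b * b * S))) ?_
  have h1 : ∀ᶠ q : ℕ × ℝ in 𝓟 (Set.Ici p) ×ˢ 𝓝[>] (0 : ℝ), p ≤ q.1 :=
    (eventually_principal.2 fun n hn => hn).prod_inl _
  have h2 : ∀ᶠ q : ℕ × ℝ in 𝓟 (Set.Ici p) ×ˢ 𝓝[>] (0 : ℝ), 0 < q.2 :=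
    (eventually_mem_nhdsWithin).prod_inr _
  have h3 : ∀ᶠ q : ℕ × ℝ in 𝓟 (Set.Ici p) ×ˢ 𝓝[>] (0 : ℝ),
      (q.2 ^ 2)⁻¹ ≤ q.2 ^ (2 * α) * Real.exp (Real.pi / q.2) :=
    (eventually_inv_sq_le α).prod_inr _
  filter_upwards [h1, h2, h3] with ⟨n, h⟩ hn hh hE
  dsimp only at hn hh hE ⊢
  set E := h ^ (2 * α) * Real.exp (Real.pi / h) with hEdef
  have hE0 : 0 ≤ E := by positivity
  have hn' : (p : ℝ) ≤ n := by exact_mod_cast hn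
  have hp' : (1 : ℝ) ≤ p := by exact_mod_cast hp
  set N : ℝ := (n : ℝ) - p + 1 with hN
  have hN0 : 0 < N := by linarith
  have hn0 : (0 : ℝ) < n := by linarith
  have hcard : ((Finset.Icc p n).card : ℝ) = N := by
    rw [Nat.card_Icc, Nat.cast_sub (by omega)]
    push_cast
    ring
  have hv := hw.variance_sum_deconvKernel_le hX hσ_meas hZ_meas hσ_pos hσ_stat hZ_indep hZ_gauss hσZ
    hsum hf_nonneg hf hf_density hM hh x (hb h x) (Finset.Icc p n)
  rw [hcard] at hv
  rw [Real.norm_of_nonneg (variance_nonneg _ _), Real.norm_of_nonneg (by positivity)]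
  unfold estimator
  rw [variance_const_mul]
  have hD : (h * ∫ y, deconvKernelOne w h y ^ 2) ^ p ≤ C ^ p * (h ^ 2) ^ p * E ^ p := by
    rw [← mul_pow, ← mul_pow]
    refine pow_le_pow_left₀ (mul_nonneg hh.le (integral_nonneg fun _ => sq_nonneg _)) ?_ p
    calc h * ∫ y, deconvKernelOne w h y ^ 2 ≤ h * (C * (h * E)) := by gcongr; exact hCb h hh
      _ = C * h ^ 2 * E := by ring
  have hone : 1 ≤ (h ^ 2) ^ p * E ^ p := by
    rw [← mul_pow]
    refine one_le_pow₀ ?_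
    rwa [inv_le_iff_one_le_mul₀' (by positivity)] at hE
  have hbr : p * (M * (h * ∫ y, deconvKernelOne w h y ^ 2) ^ p) + 4 * b * b * S ≤
      (p * (M * C ^ p) + 4 * b * b * S) * ((h ^ 2) ^ p * E ^ p) := by
    have e1 : p * (M * (h * ∫ y, deconvKernelOne w h y ^ 2) ^ p) ≤
        p * (M * (C ^ p * (h ^ 2) ^ p * E ^ p)) := by gcongr
    have e2 : 4 * b * b * S * 1 ≤ 4 * b * b * S * ((h ^ 2) ^ p * E ^ p) := by gcongr
    linarith
  -- equivalent to `0 ≤ (p - 1) (n - p)`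
  have hNn : 1 / N ≤ p * (1 / n) := by
    rw [mul_one_div, div_le_div_iff₀ hN0 hn0]
    nlinarith
  calc (1 / (N * h ^ p)) ^ 2 * Var[fun ω => ∑ j ∈ Finset.Icc p n,
          deconvKernel p w h (h⁻¹ • (x - logSqVec p X (j : ℤ) ω)); μ]
      ≤ (1 / (N * h ^ p)) ^ 2 * (N * (2 * ((p * (M * C ^ p) + 4 * b * b * S) *
          ((h ^ 2) ^ p * E ^ p)))) := by
        refine mul_le_mul_of_nonneg_left (hv.trans ?_) (by positivity)
        gcongr
    _ = 1 / N * (2 * (p * (M * C ^ p) + 4 * b * b * S)) * E ^ p := by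
        rw [← pow_mul h 2 p, mul_comm 2 p, pow_mul]
        field_simp
    _ ≤ p * (1 / n) * (2 * (p * (M * C ^ p) + 4 * b * b * S)) * E ^ p := by gcongr
    _ = _ := by ring

end Estimator

/-! ### Moments of the product kernel -/

section ConditionW

variable {w : ℝ → ℝ} {A α : ℝ}

theorem ConditionW.integrable_prodKernel (hw : ConditionW w A α) (p : ℕ) :
    Integrable (prodKernel p w) :=
  Integrable.fintype_prod (f := fun _ : Fin p => w) fun _ => hw.integrable

theorem ConditionW.integral_prodKernel (hw : ConditionW w A α) (p : ℕ) :
    ∫ u, prodKernel p w u = 1 := by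
  unfold prodKernel
  rw [integral_fintype_prod_volume_eq_prod (fun _ : Fin p => w)]
  simp [hw.integral_eq_one]

theorem ConditionW.prodKernel_neg (hw : ConditionW w A α) {p : ℕ} (u : Fin p → ℝ) :
    prodKernel p w (-u) = prodKernel p w u := by
  simp [prodKernel, hw.symm]

theorem ConditionW.integrable_sq_mul_prodKernel (hw : ConditionW w A α) {p : ℕ} (i : Fin p) :
    Integrable fun u : Fin p → ℝ => u i ^ 2 * prodKernel p w u := by
  have h : Integrable fun u : Fin p → ℝ =>
      ∏ k, (if k = i then (fun v => v ^ 2 * w v) else w) (u k) :=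
    Integrable.fintype_prod (f := fun k : Fin p => if k = i then (fun v => v ^ 2 * w v) else w)
      fun k => by
        split_ifs
        · exact hw.integrable_sq
        · exact hw.integrable
  refine h.congr (ae_of_all _ fun u => ?_)
  dsimp only
  rw [prodKernel, ← Finset.mul_prod_erase _ _ (Finset.mem_univ i),
    ← Finset.mul_prod_erase _ (fun k => w (u k)) (Finset.mem_univ i), if_pos rfl, mul_assoc]
  congr 2
  refine Finset.prod_congr rfl fun k hk => ?_
  rw [if_neg (Finset.ne_of_mem_erase hk)]

theorem norm_sq_le_sum_sq {p : ℕ} (u : Fin p → ℝ) : ‖u‖ ^ 2 ≤ ∑ i, u i ^ 2 := by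
  have h0 : 0 ≤ ∑ i, u i ^ 2 := Finset.sum_nonneg fun i _ => sq_nonneg _
  rw [← Real.sqrt_le_sqrt_iff h0, Real.sqrt_sq (norm_nonneg u),
    pi_norm_le_iff_of_nonneg (Real.sqrt_nonneg _)]
  intro i
  refine Real.abs_le_sqrt ?_
  exact Finset.single_le_sum (f := fun i => u i ^ 2) (fun i _ => sq_nonneg _) (Finset.mem_univ i)

theorem ConditionW.integrable_norm_sq_mul_prodKernel (hw : ConditionW w A α) (p : ℕ) :
    Integrable fun u : Fin p → ℝ => ‖u‖ ^ 2 * prodKernel p w u := by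
  have h : Integrable fun u : Fin p → ℝ => ∑ i, ‖u i ^ 2 * prodKernel p w u‖ :=
    integrable_finsetSum _ fun i _ => (hw.integrable_sq_mul_prodKernel i).norm
  refine h.mono' ?_ (ae_of_all _ fun u => ?_)
  · exact (by fun_prop : AEStronglyMeasurable fun u : Fin p → ℝ => ‖u‖ ^ 2).mul
      (hw.integrable_prodKernel p).1
  · simp_rw [norm_mul]
    rw [← Finset.sum_mul]
    gcongr
    refine le_trans (le_of_eq ?_) ((norm_sq_le_sum_sq u).trans (le_of_eq ?_)) <;> simp

theorem ConditionW.integrable_clm_mul_prodKernel (hw : ConditionW w A α) {p : ℕ}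
    (L : (Fin p → ℝ) →L[ℝ] ℝ) : Integrable fun u => L u * prodKernel p w u := by
  have h := ((hw.integrable_prodKernel p).norm.add
    (hw.integrable_norm_sq_mul_prodKernel p).norm).const_mul ‖L‖
  refine h.mono' ?_ (ae_of_all _ fun u => ?_)
  · exact L.continuous.aestronglyMeasurable.mul (hw.integrable_prodKernel p).1
  · simp only [Pi.add_apply, norm_mul, norm_pow, norm_norm]
    calc ‖L u‖ * ‖prodKernel p w u‖ ≤ (‖L‖ * ‖u‖) * ‖prodKernel p w u‖ := by
          gcongr; exact L.le_opNorm u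
      _ ≤ (‖L‖ * (1 + ‖u‖ ^ 2)) * ‖prodKernel p w u‖ := by
          gcongr
          nlinarith [sq_nonneg (‖u‖ - 1), norm_nonneg u]
      _ = _ := by ring

theorem ConditionW.integral_clm_mul_prodKernel (hw : ConditionW w A α) {p : ℕ}
    (L : (Fin p → ℝ) →L[ℝ] ℝ) : ∫ u, L u * prodKernel p w u = 0 := by
  have := integral_neg_eq_self (fun u => L u * prodKernel p w u) volume
  simp only [map_neg, hw.prodKernel_neg, neg_mul, integral_neg] at this
  linarith

theorem ConditionW.prodKernel_contVersion_ae_eq (hw : ConditionW w A α) (p : ℕ) :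
    prodKernel p (contVersion w) =ᵐ[volume] prodKernel p w := by
  have : ∀ i : Fin p, ∀ᵐ u : Fin p → ℝ, contVersion w (u i) = w (u i) := fun i =>
    (Measure.quasiMeasurePreserving_eval (fun _ : Fin p => (volume : Measure ℝ)) i).ae
      hw.contVersion_ae_eq
  filter_upwards [ae_all_iff.2 this] with u hu
  exact Finset.prod_congr rfl fun i _ => hu i

end ConditionW

/-! ### Second order Taylor expansion -/

/-- The quadratic form of the Hessian. -/
noncomputable def hessianForm {p : ℕ} (f : (Fin p → ℝ) → ℝ) (y u : Fin p → ℝ) : ℝ :=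
  u ⬝ᵥ (hessian f y *ᵥ u)

theorem hessianForm_eq {p : ℕ} (f : (Fin p → ℝ) → ℝ) (y u : Fin p → ℝ) :
    hessianForm f y u = fderiv ℝ (fderiv ℝ f) y u u := by
  have hu : u = ∑ i, u i • Pi.single i (1 : ℝ) := by
    simpa using (pi_eq_sum_univ' u)
  conv_rhs => rw [hu]
  simp only [map_sum, map_smul, _root_.sum_apply, _root_.smul_apply,
    smul_eq_mul, hessianForm, dotProduct, Matrix.mulVec, hessian, Matrix.of_apply, Finset.mul_sum]
  rw [Finset.sum_comm]
  refine Finset.sum_congr rfl fun i _ => Finset.sum_congr rfl fun j _ => ?_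
  ring

theorem hessianForm_smul {p : ℕ} (f : (Fin p → ℝ) → ℝ) (y u : Fin p → ℝ) (c : ℝ) :
    hessianForm f y (c • u) = c ^ 2 * hessianForm f y u := by
  simp only [hessianForm_eq, map_smul, _root_.smul_apply, smul_eq_mul]
  ring

theorem continuous_hessianForm {p : ℕ} {f : (Fin p → ℝ) → ℝ} (hf : ContDiff ℝ 2 f) :
    Continuous (Function.uncurry (hessianForm f)) := by
  have h1 : ContDiff ℝ 1 (fderiv ℝ f) := hf.fderiv_right (by norm_num)
  have h2 : Continuous (fderiv ℝ (fderiv ℝ f)) := h1.continuous_fderiv (by norm_num)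
  have e : Function.uncurry (hessianForm f) =
      fun q => fderiv ℝ (fderiv ℝ f) q.1 q.2 q.2 := funext fun q => hessianForm_eq f q.1 q.2
  rw [e]
  fun_prop

theorem abs_hessianForm_le {p : ℕ} {f : (Fin p → ℝ) → ℝ} {M : ℝ}
    (hM : ∀ x i j, |hessian f x i j| ≤ M) (y u : Fin p → ℝ) :
    |hessianForm f y u| ≤ p ^ 2 * M * ‖u‖ ^ 2 := by
  unfold hessianForm dotProduct Matrix.mulVec dotProduct
  have hu : ∀ i, |u i| ≤ ‖u‖ := fun i => norm_le_pi_norm u i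
  calc |∑ i, u i * ∑ j, hessian f y i j * u j|
      ≤ ∑ i, ∑ j, |u i * (hessian f y i j * u j)| := by
        simp_rw [Finset.mul_sum]
        exact (Finset.abs_sum_le_sum_abs _ _).trans
          (Finset.sum_le_sum fun i _ => Finset.abs_sum_le_sum_abs _ _)
    _ ≤ ∑ _i : Fin p, ∑ _j : Fin p, ‖u‖ * (M * ‖u‖) := by
        refine Finset.sum_le_sum fun i _ => Finset.sum_le_sum fun j _ => ?_
        rw [abs_mul, abs_mul]
        have hM0 : 0 ≤ M := (abs_nonneg _).trans (hM y i j)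
        gcongr
        · exact hu i
        · exact hM y i j
        · exact hu j
    _ = _ := by
        simp
        ring

/-- Taylor's formula at order two with Lagrange remainder, assuming only that the second derivative
exists. -/
theorem exists_taylor_two {φ φ' φ'' : ℝ → ℝ} (h1 : ∀ t, HasDerivAt φ (φ' t) t)
    (h2 : ∀ t, HasDerivAt φ' (φ'' t) t) :
    ∃ ξ ∈ Set.Ioo (0 : ℝ) 1, φ 1 = φ 0 + φ' 0 + φ'' ξ / 2 := by
  -- with this `K`, the function `t ↦ φ t - φ' 0 t - K t²` takes the same value at `0` and at `1`
  set K := φ 1 - φ 0 - φ' 0 with hK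
  have hg : ∀ t, HasDerivAt (fun t => φ t - φ' 0 * t - K * t ^ 2) (φ' t - φ' 0 - 2 * K * t) t := by
    intro t
    have := ((h1 t).sub ((hasDerivAt_id t).const_mul (φ' 0))).sub
      ((hasDerivAt_pow 2 t).const_mul K)
    refine this.congr_deriv ?_
    simp
    ring
  have hg' : ∀ t, HasDerivAt (fun t => φ' t - φ' 0 - 2 * K * t) (φ'' t - 2 * K) t := by
    intro t
    have := ((h2 t).sub_const (φ' 0)).sub ((hasDerivAt_id t).const_mul (2 * K))
    exact this.congr_deriv (by simp)
  obtain ⟨c, hc, hc0⟩ := exists_hasDerivAt_eq_zero zero_lt_one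
    (fun t _ => (hg t).continuousAt.continuousWithinAt) (by simp [hK]) fun t _ => hg t
  obtain ⟨ξ, hξ, hξ0⟩ := exists_hasDerivAt_eq_zero hc.1
    (fun t _ => (hg' t).continuousAt.continuousWithinAt) (by simp [hc0]) fun t _ => hg' t
  refine ⟨ξ, ⟨hξ.1, hξ.2.trans hc.2⟩, ?_⟩
  linarith

theorem exists_taylor_hessianForm {p : ℕ} {f : (Fin p → ℝ) → ℝ} (hf : ContDiff ℝ 2 f)
    (x v : Fin p → ℝ) :
    ∃ ξ ∈ Set.Ioo (0 : ℝ) 1,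
      f (x + v) = f x + fderiv ℝ f x v + hessianForm f (x + ξ • v) v / 2 := by
  have hl : ∀ t : ℝ, HasDerivAt (fun t : ℝ => x + t • v) v t := fun t => by
    simpa using ((hasDerivAt_id t).smul_const v).const_add x
  have hd1 : Differentiable ℝ f := hf.differentiable (by norm_num)
  have hd2 : Differentiable ℝ (fderiv ℝ f) :=
    (hf.fderiv_right (m := 1) (by norm_num)).differentiable (by norm_num)
  obtain ⟨ξ, hξ, h⟩ := exists_taylor_two (φ := fun t : ℝ => f (x + t • v))
    (φ' := fun t => fderiv ℝ f (x + t • v) v)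
    (φ'' := fun t => fderiv ℝ (fderiv ℝ f) (x + t • v) v v)
    (fun t => (hd1 _).hasFDerivAt.comp_hasDerivAt t (hl t))
    (fun t => (((hd2 _).hasFDerivAt.comp_hasDerivAt t (hl t)).clm_apply
      (hasDerivAt_const t v)).congr_deriv (by simp))
  refine ⟨ξ, hξ, ?_⟩
  simpa [hessianForm_eq] using h

/-! ### The bias of the estimator -/

section Bias

variable {p : ℕ} {w : ℝ → ℝ} {A α : ℝ} {f : (Fin p → ℝ) → ℝ}

theorem ConditionW.integrable_hessianForm_mul_prodKernel (hw : ConditionW w A α)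
    (hf : ContDiff ℝ 2 f) {M : ℝ} (hM : ∀ x i j, |hessian f x i j| ≤ M) (x : Fin p → ℝ) :
    Integrable fun u => hessianForm f x u * prodKernel p w u := by
  have hc : Continuous fun u => hessianForm f x u :=
    (continuous_hessianForm hf).comp (by fun_prop : Continuous fun u => (x, u))
  refine ((hw.integrable_norm_sq_mul_prodKernel p).norm.const_mul (p ^ 2 * M)).mono'
    (hc.aestronglyMeasurable.mul (hw.integrable_prodKernel p).1) (ae_of_all _ fun u => ?_)
  rw [norm_mul, norm_mul, norm_pow, norm_norm, ← mul_assoc]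
  exact mul_le_mul_of_nonneg_right (abs_hessianForm_le hM x u) (norm_nonneg _)

/-- The bias of a kernel smoother with a symmetric kernel `w`: the linear Taylor term integrates to
zero, and the second order remainder is controlled by dominated convergence. -/
theorem ConditionW.bias_isLittleO (hw : ConditionW w A α) (hf : ContDiff ℝ 2 f) {B : ℝ}
    (hB : ∀ x, |f x| ≤ B) {M : ℝ} (hM : ∀ x i j, |hessian f x i j| ≤ M) (x : Fin p → ℝ) :
    (fun h : ℝ => (∫ u, f (x - h • u) * prodKernel p w u) -
        (f x + 1 / 2 * h ^ 2 * ∫ u, hessianForm f x u * prodKernel p w u))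
      =o[𝓝[>] 0] fun h : ℝ => h ^ 2 := by
  have hfi : ∀ h : ℝ, Integrable fun u => f (x - h • u) * prodKernel p w u := fun h =>
    (hw.integrable_prodKernel p).bdd_mul (c := B)
      (hf.continuous.comp (by fun_prop)).aestronglyMeasurable (ae_of_all _ fun u => hB _)
  have hHi := hw.integrable_hessianForm_mul_prodKernel hf hM x
  -- the Taylor remainder divided by `h²`
  set R : ℝ → (Fin p → ℝ) → ℝ := fun h u =>
    (h ^ 2)⁻¹ * (f (x - h • u) - f x + h * fderiv ℝ f x u) - 1 / 2 * hessianForm f x u with hR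
  have hRξ : ∀ h : ℝ, 0 < h → ∀ u, ∃ ξ ∈ Set.Ioo (0 : ℝ) 1, R h u =
      1 / 2 * (hessianForm f (x - (ξ * h) • u) u - hessianForm f x u) := by
    intro h hh u
    obtain ⟨ξ, hξ, e⟩ := exists_taylor_hessianForm hf x (-(h • u))
    refine ⟨ξ, hξ, ?_⟩
    rw [← neg_smul, hessianForm_smul, smul_smul, map_smul, mul_neg, neg_smul, neg_smul,
      neg_smul, ← sub_eq_add_neg, ← sub_eq_add_neg, ← sub_eq_add_neg] at e
    simp only [hR]
    rw [e, smul_eq_mul]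
    field_simp
    ring
  have hlim : Tendsto (fun h : ℝ => ∫ u, R h u * prodKernel p w u) (𝓝[>] 0) (𝓝 0) := by
    suffices h0 : Tendsto (fun h : ℝ => ∫ u, R h u * prodKernel p w u) (𝓝[>] 0)
        (𝓝 (∫ _u : Fin p → ℝ, (0 : ℝ))) by simpa using h0
    refine tendsto_integral_filter_of_dominated_convergence
      (fun u => p ^ 2 * M * ‖‖u‖ ^ 2 * prodKernel p w u‖) ?_ ?_
      ((hw.integrable_norm_sq_mul_prodKernel p).norm.const_mul _) (ae_of_all _ fun u => ?_)
    · refine Eventually.of_forall fun h => ?_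
      have hc : Continuous fun u => hessianForm f x u :=
        (continuous_hessianForm hf).comp (by fun_prop : Continuous fun u => (x, u))
      have hcf := hf.continuous
      exact (by fun_prop : Continuous (R h)).aestronglyMeasurable.mul
        (hw.integrable_prodKernel p).1
    · filter_upwards [self_mem_nhdsWithin] with h (hh : 0 < h)
      refine ae_of_all _ fun u => ?_
      obtain ⟨ξ, -, e⟩ := hRξ h hh u
      rw [norm_mul, norm_mul, norm_pow, norm_norm, ← mul_assoc]
      refine mul_le_mul_of_nonneg_right ?_ (norm_nonneg _)
      have h1 := abs_le.1 (abs_hessianForm_le hM (x - (ξ * h) • u) u)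
      have h2 := abs_le.1 (abs_hessianForm_le hM x u)
      rw [e, Real.norm_eq_abs, abs_le]
      constructor <;> linarith
    · suffices h0 : Tendsto (fun h => R h u) (𝓝[>] 0) (𝓝 0) by
        simpa using h0.mul_const (prodKernel p w u)
      have hc : Continuous fun s : ℝ =>
          1 / 2 * (hessianForm f (x - s • u) u - hessianForm f x u) := by
        have := (continuous_hessianForm hf).comp
          (by fun_prop : Continuous fun s : ℝ => (x - s • u, u))
        simp only [Function.comp_def, Function.uncurry] at this
        fun_prop
      have hc0 := hc.tendsto 0
      simp only [zero_smul, sub_zero, sub_self, mul_zero] at hc0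
      rw [Metric.tendsto_nhds_nhds] at hc0
      rw [Metric.tendsto_nhds]
      intro ε hε
      obtain ⟨δ, hδ, hδε⟩ := hc0 ε hε
      filter_upwards [Ioo_mem_nhdsGT hδ] with h hh
      obtain ⟨ξ, hξ, e⟩ := hRξ h hh.1 u
      rw [e]
      refine hδε ?_
      rw [Real.dist_eq, sub_zero, abs_of_pos (mul_pos hξ.1 hh.1)]
      nlinarith [hξ.2, hh.1, hh.2, hξ.1]
  refine (isLittleO_iff_tendsto' ?_).2 ?_
  · filter_upwards [self_mem_nhdsWithin] with h (hh : 0 < h) h0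
    exact absurd h0 (by positivity)
  refine hlim.congr' ?_
  filter_upwards [self_mem_nhdsWithin] with h (hh : 0 < h)
  have hLi := hw.integrable_clm_mul_prodKernel (fderiv ℝ f x)
  have hKi := hw.integrable_prodKernel p
  have e : ∀ u, R h u * prodKernel p w u = (h ^ 2)⁻¹ * (f (x - h • u) * prodKernel p w u -
      f x * prodKernel p w u + h * (fderiv ℝ f x u * prodKernel p w u)) -
      1 / 2 * (hessianForm f x u * prodKernel p w u) := fun u => by
    simp only [hR]
    ring
  simp_rw [e]
  have i1 : Integrable fun u => f (x - h • u) * prodKernel p w u - f x * prodKernel p w u :=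
    (hfi h).sub (hKi.const_mul _)
  have i2 : Integrable fun u => h * (fderiv ℝ f x u * prodKernel p w u) := hLi.const_mul _
  have i3 : Integrable fun u => (h ^ 2)⁻¹ * (f (x - h • u) * prodKernel p w u -
      f x * prodKernel p w u + h * (fderiv ℝ f x u * prodKernel p w u)) := (i1.add i2).const_mul _
  rw [integral_sub i3 (hHi.const_mul _), integral_const_mul, integral_add i1 i2,
    integral_sub (hfi h) (hKi.const_mul _), integral_const_mul, integral_const_mul,
    integral_const_mul, hw.integral_clm_mul_prodKernel, hw.integral_prodKernel]
  field_simp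
  ring

variable {Ω : Type*} [MeasurableSpace Ω] {μ : Measure Ω}
  {σ Z X : ℤ → Ω → ℝ}

/-- The substitution `l = x - h u`. Replacing `contVersion w` by `w` is harmless here, since only
the integral over `u` matters. -/
theorem ConditionW.integral_smoothTerm (hw : ConditionW w A α)
    (hσ_meas : ∀ t, Measurable (σ t)) (hσ_stat : StrictlyStationary σ μ)
    (hf_nonneg : ∀ x, 0 ≤ f x) (hf : Measurable f)
    (hf_density : μ.map (logSqVec p σ (p : ℤ)) = volume.withDensity fun x => ENNReal.ofReal (f x))
    {h : ℝ} (hh : 0 < h) (x : Fin p → ℝ) (j : ℤ) :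
    ∫ ω, smoothTerm p w h x j (fun t => σ t ω) ∂μ =
      h ^ p * ∫ u, f (x - h • u) * prodKernel p w u := by
  have hm : Measurable (prodKernel p (contVersion w)) := by
    have := hw.continuous_contVersion.measurable
    unfold prodKernel
    fun_prop
  have e1 : ∫ ω, smoothTerm p w h x j (fun t => σ t ω) ∂μ =
      ∫ l, f l * prodKernel p (contVersion w) (h⁻¹ • (x - l)) :=
    integral_logSqVec hσ_stat hσ_meas hf_nonneg hf hf_density j
      (G := fun l => prodKernel p (contVersion w) (h⁻¹ • (x - l))) (by fun_prop)
  have e2 : ∀ l, f l * prodKernel p (contVersion w) (h⁻¹ • (x - l)) =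
      (fun v => (fun u => f (x - h • u) * prodKernel p (contVersion w) u) (h⁻¹ • v)) (x - l) := by
    intro l
    simp [smul_smul, mul_inv_cancel₀ hh.ne']
  rw [e1]
  simp_rw [e2]
  rw [integral_sub_left_eq_self (fun v => (fun u => f (x - h • u) *
      prodKernel p (contVersion w) u) (h⁻¹ • v)),
    Measure.integral_comp_smul volume (fun u => f (x - h • u) * prodKernel p (contVersion w) u)]
  rw [Module.finrank_fin_fun, inv_pow, inv_inv, abs_of_pos (by positivity), smul_eq_mul]
  congr 1
  refine integral_congr_ae ?_
  filter_upwards [hw.prodKernel_contVersion_ae_eq p] with u hu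
  rw [hu]

variable [IsProbabilityMeasure μ]

theorem ConditionW.integral_estimator (hw : ConditionW w A α)
    (hX : ∀ t ω, X t ω = σ t ω * Z t ω) (hσ_meas : ∀ t, Measurable (σ t))
    (hZ_meas : ∀ t, Measurable (Z t)) (hσ_pos : ∀ t, ∀ᵐ ω ∂μ, 0 < σ t ω)
    (hσ_stat : StrictlyStationary σ μ)
    (hZ_indep : iIndepFun Z μ) (hZ_gauss : ∀ t, μ.map (Z t) = gaussianReal 0 1)
    (hσZ : IndepFun (fun ω t => σ t ω) (fun ω t => Z t ω) μ)
    (hf_nonneg : ∀ x, 0 ≤ f x) (hf : Measurable f)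
    (hf_density : μ.map (logSqVec p σ (p : ℤ)) = volume.withDensity fun x => ENNReal.ofReal (f x))
    {n : ℕ} (hn : p ≤ n) {h : ℝ} (hh : 0 < h) (x : Fin p → ℝ) :
    ∫ ω, estimator p w X n h x ω ∂μ = ∫ u, f (x - h • u) * prodKernel p w u := by
  have hX_meas : ∀ t, Measurable (X t) := fun t => by
    rw [funext (hX t)]
    exact (hσ_meas t).mul (hZ_meas t)
  have hn' : (p : ℝ) ≤ n := by exact_mod_cast hn
  have hN0 : (n : ℝ) - p + 1 ≠ 0 := by linarith
  unfold estimator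
  rw [integral_const_mul, integral_finsetSum _ fun (j : ℕ) _ =>
    (hw.memLp_deconvKernel (μ := μ) hX_meas h x (j : ℤ)).integrable (by norm_num)]
  simp_rw [hw.integral_deconvKernel hX hσ_meas hZ_meas hσ_pos hZ_indep hZ_gauss hσZ h x,
    hw.integral_smoothTerm hσ_meas hσ_stat hf_nonneg hf hf_density hh x]
  rw [Finset.sum_const, Nat.card_Icc, nsmul_eq_mul, Nat.cast_sub (by omega)]
  push_cast
  rw [show (n : ℝ) + 1 - p = n - p + 1 by ring]
  field_simp

end Bias

end VolDeconv

theorem theorem2 {Ω : Type*} [MeasurableSpace Ω] (μ : Measure Ω) [IsProbabilityMeasure μ]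
    (p : ℕ) (hp : 1 ≤ p)
    -- the model: `X_t = σ_t Z_t`
    (σ Z X : ℤ → Ω → ℝ)
    (hσ_meas : ∀ t, Measurable (σ t)) (hZ_meas : ∀ t, Measurable (Z t))
    (hX : ∀ t ω, X t ω = σ t ω * Z t ω)
    (hσ_pos : ∀ t, ∀ᵐ ω ∂μ, 0 < σ t ω)
    (hσ_stat : StrictlyStationary σ μ)
    (hZ_indep : iIndepFun Z μ)
    (hZ_gauss : ∀ t, μ.map (Z t) = gaussianReal 0 1)
    -- the processes `σ` and `Z` are independent
    (hσZ : IndepFun (fun ω t => σ t ω) (fun ω t => Z t ω) μ)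
    -- mixing
    (β : ℝ) (hβ : β ∈ Set.Ioo (0 : ℝ) 1)
    (hmix : StronglyMixing σ μ)
    (hsum : Summable fun j : ℕ => mixingCoeff σ μ (j + 1) ^ β)
    -- the kernel
    (w : ℝ → ℝ) (A α : ℝ) (hw : ConditionW w A α)
    -- the density of `(log σ_p², …, log σ_1²)`
    (f : (Fin p → ℝ) → ℝ) (hf_nonneg : ∀ x, 0 ≤ f x)
    (hf_density : μ.map (logSqVec p σ (p : ℤ)) = volume.withDensity fun x => ENNReal.ofReal (f x))
    (hf_bdd : ∃ M : ℝ, ∀ x, |f x| ≤ M)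
    (hf_smooth : ContDiff ℝ 2 f)
    (hf_hess : ∃ M : ℝ, ∀ x i j, |hessian f x i j| ≤ M)
    (x : Fin p → ℝ) :
    -- the moments exist
    (∀ n : ℕ, p ≤ n → ∀ h : ℝ, 0 < h → MemLp (estimator p w X n h x) 2 μ) ∧
    Integrable (fun u : Fin p → ℝ => (u ⬝ᵥ (hessian f x *ᵥ u)) * prodKernel p w u) ∧
    -- the bias expansion, as `h ↓ 0`, uniformly in `n ≥ p`
    ((fun q : ℕ × ℝ => (∫ ω, estimator p w X q.1 q.2 x ω ∂μ) -
        (f x + 1 / 2 * q.2 ^ 2 *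
          ∫ u : Fin p → ℝ, (u ⬝ᵥ (hessian f x *ᵥ u)) * prodKernel p w u))
      =o[𝓟 (Set.Ici p) ×ˢ 𝓝[>] 0] fun q : ℕ × ℝ => q.2 ^ 2) ∧
    -- the variance bound, as `h ↓ 0`, uniformly in `n ≥ p`
    ((fun q : ℕ × ℝ => variance (estimator p w X q.1 q.2 x) μ)
      =O[𝓟 (Set.Ici p) ×ˢ 𝓝[>] 0]
        fun q : ℕ × ℝ => 1 / (q.1 : ℝ) * (q.2 ^ (2 * α) * Real.exp (Real.pi / q.2)) ^ p) := by
  have hX_meas : ∀ t, Measurable (X t) := fun t => by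
    rw [funext (hX t)]
    exact (hσ_meas t).mul (hZ_meas t)
  obtain ⟨B, hB⟩ := hf_bdd
  obtain ⟨M, hM⟩ := hf_hess
  have hf_meas : Measurable f := hf_smooth.continuous.measurable
  refine ⟨fun n _ h _ => hw.memLp_estimator hX_meas n h x,
    hw.integrable_hessianForm_mul_prodKernel hf_smooth hM x, ?_,
    hw.variance_estimator_isBigO hp hX hσ_meas hZ_meas hσ_pos hσ_stat hZ_indep hZ_gauss hσZ
      (summable_mixingCoeff hβ hsum) hf_nonneg hf_meas hf_density
      (fun y => (le_abs_self _).trans (hB y)) x⟩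
  -- the mean does not depend on `n ≥ p`, so uniformity in `n` is automatic
  have h0 := (hw.bias_isLittleO hf_smooth hB hM x).comp_tendsto
    (tendsto_snd (f := 𝓟 (Set.Ici p)) (g := 𝓝[>] (0 : ℝ)))
  have h1 : ∀ᶠ q : ℕ × ℝ in 𝓟 (Set.Ici p) ×ˢ 𝓝[>] (0 : ℝ), p ≤ q.1 :=
    (eventually_principal.2 fun n hn => hn).prod_inl _
  have h2 : ∀ᶠ q : ℕ × ℝ in 𝓟 (Set.Ici p) ×ˢ 𝓝[>] (0 : ℝ), 0 < q.2 :=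
    (eventually_mem_nhdsWithin).prod_inr _
  refine h0.congr' ?_ EventuallyEq.rfl
  filter_upwards [h1, h2] with q hn hh
  rw [hw.integral_estimator hX hσ_meas hZ_meas hσ_pos hσ_stat hZ_indep hZ_gauss hσZ hf_nonneg
    hf_meas hf_density hn hh x]
  rfl
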